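/- A groupoid $\mathcal G$ is viewed as its set of arrows, with objects identified with identity arrows; $\mathcal G^0$ is the set of identities and $d,r$ are the domain and range maps. An ample groupoid is a groupoid with a topology for which domain, range, multiplication and inversion are continuous, $d\colon\mathcal G\to\mathcal G^0$ is a local homeomorphism, and $\mathcal G^0$ (with the subspace topology) is locally compact and Hausdorff and has a basis of compact open sets; $\mathcal G$ itself need not be Hausdorff. A compact local bisection is a compact open set $U\subseteq\mathcal G$ such that $d|_U$ and $r|_U$ are homeomorphisms onto their images. For a commutative ring $K$ with unit, the Steinberg algebra $K\mathcal G$ is the $K$-span of the characteristic functions of compact local bisections, inside $K^{\mathcal G}$, with the convolution product $(f*g)(\gamma)=\sum_{\alpha\beta=\gamma}f(\alpha)g(\beta)$. A function $f\in K\mathcal G$ is singular if its support $\{\gamma\in\mathcal G: f(\gamma)\neq 0\}$ has empty interior; the singular functions form a two-sided ideal of $K\mathcal G$, the singular ideal, denoted $\mathrm{Sing}_K(\mathcal G)$. An algebra is simple if it is nonzero and its only two-sided ideals are $0$ and itself. Corollary. Let $\mathcal G$ be an ample groupoid. (1) If $\mathrm{Sing}_F(\mathcal G)=0$ for some field $F$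 of positive characteristic, then $\mathrm{Sing}_K(\mathcal G)=0$ for all fields $K$ of characteristic $0$. (2) If $F\mathcal G$ is simple for some field $F$ of positive characteristic, then $K\mathcal G$ is simple for all fields $K$ of characteristic $0$. -/

import Mathlib

open Topology

/-- A groupoid, viewed as its set `G` of arrows: an object is identified with the identity arrow
at that object.  The product `comp a b` is defined when `dom a = ran b`. -/
class ArrowGroupoid (G : Type*) where
  dom : G → G
  ran : G → G
  comp : (a b : G) → dom a = ran b → G
  inv : G → G
  dom_dom : ∀ g, dom (dom g) = dom g
  ran_dom : ∀ g, ran (dom g) = dom g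
  dom_ran : ∀ g, dom (ran g) = ran g
  ran_ran : ∀ g, ran (ran g) = ran g
  dom_comp : ∀ a b h, dom (comp a b h) = dom b
  ran_comp : ∀ a b h, ran (comp a b h) = ran a
  assoc : ∀ (a b c : G) (hab : dom a = ran b) (hbc : dom b = ran c),
    comp (comp a b hab) c ((dom_comp a b hab).trans hbc) =
      comp a (comp b c hbc) (hab.trans (ran_comp b c hbc).symm)
  comp_dom : ∀ g, comp g (dom g) (ran_dom g).symm = g
  ran_comp_self : ∀ g, comp (ran g) g (dom_ran g) = g
  dom_inv : ∀ g, dom (inv g) = ran g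
  ran_inv : ∀ g, ran (inv g) = dom g
  inv_comp : ∀ g, comp (inv g) g (dom_inv g) = dom g
  comp_inv : ∀ g, comp g (inv g) (ran_inv g).symm = ran g

namespace ArrowGroupoid

/-- The unit space: the set of identity arrows. -/
def units (G : Type*) [ArrowGroupoid G] : Set G := Set.range (dom : G → G)

/-- The domain map, with values in the unit space. -/
def domUnits {G : Type*} [ArrowGroupoid G] (g : G) : units G := ⟨dom g, g, rfl⟩

/-- The product of two sets of arrows. -/
def setComp {G : Type*} [ArrowGroupoid G] (A B : Set G) : Set G :=
  {g | ∃ a ∈ A, ∃ b ∈ B, ∃ h : dom a = ran b, comp a b h = g}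

end ArrowGroupoid

/-- An ample groupoid: a topological groupoid (the domain, range, product and inversion maps are
continuous) which is étale (the domain map is a local homeomorphism onto the unit space), whose
unit space is locally compact and Hausdorff and has a basis of compact open sets.
The space of arrows need not be Hausdorff. -/
class IsAmpleGroupoid (G : Type*) [TopologicalSpace G] [ArrowGroupoid G] : Prop where
  continuous_dom : Continuous (ArrowGroupoid.dom : G → G)
  continuous_ran : Continuous (ArrowGroupoid.ran : G → G)
  continuous_comp : Continuous
    (fun p : {p : G × G // ArrowGroupoid.dom p.1 = ArrowGroupoid.ran p.2} =>
      ArrowGroupoid.comp p.1.1 p.1.2 p.2)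
  continuous_inv : Continuous (ArrowGroupoid.inv : G → G)
  isLocalHomeomorph_dom : IsLocalHomeomorph (ArrowGroupoid.domUnits (G := G))
  locallyCompact_units : LocallyCompactSpace (ArrowGroupoid.units G)
  t2_units : T2Space (ArrowGroupoid.units G)
  basis_units : TopologicalSpace.IsTopologicalBasis
    {U : Set (ArrowGroupoid.units G) | IsOpen U ∧ IsCompact U}

/-- A compact local bisection: a compact open set of arrows on which the domain and range maps
are homeomorphisms onto their images. -/
structure IsCompactLocalBisection {G : Type*} [TopologicalSpace G] [ArrowGroupoid G]
    (U : Set G) : Prop where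
  isOpen : IsOpen U
  isCompact : IsCompact U
  isEmbedding_dom : IsEmbedding (U.domRestrict (ArrowGroupoid.dom : G → G))
  isEmbedding_ran : IsEmbedding (U.domRestrict (ArrowGroupoid.ran : G → G))

/-- The convolution product `(f * g)(γ) = ∑_{αβ = γ} f(α) g(β)`. -/
noncomputable def convolution {K G : Type*} [CommRing K] [ArrowGroupoid G] (f g : G → K) :
    G → K := fun γ =>
  ∑ᶠ p : {p : G × G // ∃ h : ArrowGroupoid.dom p.1 = ArrowGroupoid.ran p.2,
    ArrowGroupoid.comp p.1 p.2 h = γ}, f p.1.1 * g p.1.2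

/-- The `K`-span of the characteristic functions of compact local bisections. -/
def steinbergSubmodule (K G : Type*) [CommRing K] [TopologicalSpace G] [ArrowGroupoid G] :
    Submodule K (G → K) :=
  Submodule.span K {f | ∃ U : Set G, IsCompactLocalBisection U ∧ f = U.indicator 1}

section Algebra

namespace ArrowGroupoid

variable {G : Type*} [ArrowGroupoid G]

theorem inv_comp_cancel (a b : G) (h : dom a = ran b) :
    comp (inv a) (comp a b h) ((dom_inv a).trans (ran_comp a b h).symm) = b := by
  rw [← assoc (inv a) a b (dom_inv a) h]
  have key : ∀ (x y : G) (hx : dom x = ran b) (_ : x = y) (_ : y = ran b), comp x b hx = b := by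
    intro x y hx e e'
    subst e; subst e'
    exact ran_comp_self b
  exact key _ _ _ (inv_comp a) h

theorem comp_inv_cancel_left (a b : G) (h : ran a = ran b) :
    comp a (comp (inv a) b ((dom_inv a).trans h))
      ((ran_comp _ _ _).trans (ran_inv a)).symm = b := by
  rw [← assoc a (inv a) b (ran_inv a).symm ((dom_inv a).trans h)]
  have key : ∀ (x y : G) (hx : dom x = ran b) (_ : x = y) (_ : y = ran b), comp x b hx = b := by
    intro x y hx e e'
    subst e; subst e'
    exact ran_comp_self b
  exact key _ _ _ (comp_inv a) h

theorem comp_inv_cancel (a b : G) (h : dom a = ran b) :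
    comp (comp a b h) (inv b) ((dom_comp a b h).trans (ran_inv b).symm) = a := by
  rw [assoc a b (inv b) h (ran_inv b).symm]
  have key : ∀ (x : G) (hx : dom a = ran x) (_ : x = dom a), comp a x hx = a := by
    intro x hx e
    subst e
    exact comp_dom a
  exact key _ _ ((comp_inv b).trans h.symm)

theorem comp_left_cancel {a b b' : G} {h : dom a = ran b} {h' : dom a = ran b'}
    (e : comp a b h = comp a b' h') : b = b' := by
  have h1 := inv_comp_cancel a b h
  have h2 := inv_comp_cancel a b' h'
  rw [← h1, ← h2]
  congr 1

theorem comp_right_cancel {a a' b : G} {h : dom a = ran b} {h' : dom a' = ran b}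
    (e : comp a b h = comp a' b h') : a = a' := by
  have h1 := comp_inv_cancel a b h
  have h2 := comp_inv_cancel a' b h'
  rw [← h1, ← h2]
  congr 1

theorem inv_inv (a : G) : inv (inv a) = a := by
  have h1 := inv_comp_cancel (inv a) a (dom_inv a)
  have key : ∀ (x : G) (hx : dom (inv (inv a)) = ran x) (_ : x = dom (inv (inv a))),
      comp (inv (inv a)) x hx = inv (inv a) := by
    intro x hx e
    subst e
    exact comp_dom _
  have e : comp (inv a) a (dom_inv a) = dom (inv (inv a)) := by
    rw [inv_comp, dom_inv, ran_inv]
  exact (key _ _ e).symm.trans h1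

theorem ran_mem_units (g : G) : ran g ∈ units G := ⟨ran g, dom_ran g⟩

/-- The range map, with values in the unit space. -/
def ranUnits (g : G) : units G := ⟨ran g, ran_mem_units g⟩

theorem setComp_assoc (A B C : Set G) :
    setComp (setComp A B) C = setComp A (setComp B C) := by
  ext g
  constructor
  · rintro ⟨_, ⟨a, ha, b, hb, hab, rfl⟩, c, hc, h, rfl⟩
    have hbc : dom b = ran c := (dom_comp a b hab).symm.trans h
    exact ⟨a, ha, _, ⟨b, hb, c, hc, hbc, rfl⟩, _, (assoc a b c hab hbc).symm⟩
  · rintro ⟨a, ha, _, ⟨b, hb, c, hc, hbc, rfl⟩, h, rfl⟩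
    have hab : dom a = ran b := h.trans (ran_comp b c hbc)
    exact ⟨_, ⟨a, ha, b, hb, hab, rfl⟩, c, hc, _, assoc a b c hab hbc⟩

end ArrowGroupoid

open ArrowGroupoid

section Topological

variable {G : Type*} [TopologicalSpace G] [ArrowGroupoid G]

theorem IsCompactLocalBisection.dom_inj {U : Set G} (hU : IsCompactLocalBisection U) {a b : G}
    (ha : a ∈ U) (hb : b ∈ U) (h : dom a = dom b) : a = b :=
  congrArg Subtype.val (hU.isEmbedding_dom.injective (a₁ := ⟨a, ha⟩) (a₂ := ⟨b, hb⟩) h)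

theorem IsCompactLocalBisection.ran_inj {U : Set G} (hU : IsCompactLocalBisection U) {a b : G}
    (ha : a ∈ U) (hb : b ∈ U) (h : ran a = ran b) : a = b :=
  congrArg Subtype.val (hU.isEmbedding_ran.injective (a₁ := ⟨a, ha⟩) (a₂ := ⟨b, hb⟩) h)

namespace IsAmpleGroupoid

variable [IsAmpleGroupoid G]

theorem continuous_domUnits : Continuous (domUnits (G := G)) :=
  continuous_dom.subtype_mk _

theorem continuous_ranUnits : Continuous (ranUnits (G := G)) :=
  continuous_ran.subtype_mk _

theorem isOpenMap_domUnits : IsOpenMap (domUnits (G := G)) :=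
  isLocalHomeomorph_dom.isOpenMap

theorem isOpen_inv_image {A : Set G} (hA : IsOpen A) : IsOpen (inv '' A) := by
  have : inv '' A = inv ⁻¹' A :=
    congrFun (Set.image_eq_preimage_of_inverse ArrowGroupoid.inv_inv ArrowGroupoid.inv_inv) A
  rw [this]
  exact hA.preimage continuous_inv

theorem isOpenMap_ranUnits : IsOpenMap (ranUnits (G := G)) := by
  have : ranUnits (G := G) = domUnits ∘ inv := by
    funext g
    exact Subtype.ext (dom_inv g).symm
  rw [this]
  exact isOpenMap_domUnits.comp fun A hA => isOpen_inv_image hA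

theorem isOpen_setComp {A B : Set G} (hA : IsOpen A) (hB : IsOpen B) : IsOpen (setComp A B) := by
  have hc : Continuous (fun p : {p : G × G // ran p.1 = ran p.2} =>
      comp (inv p.1.1) p.1.2 ((dom_inv _).trans p.2)) :=
    (continuous_comp (G := G)).comp
      (f := fun p : {p : G × G // ran p.1 = ran p.2} =>
        (⟨(inv p.1.1, p.1.2), (dom_inv _).trans p.2⟩ :
          {p : G × G // ArrowGroupoid.dom p.1 = ArrowGroupoid.ran p.2}))
      (((continuous_inv.comp (continuous_fst.comp continuous_subtype_val)).prodMk
        (continuous_snd.comp continuous_subtype_val)).subtype_mk _)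
  have hS := (hA.preimage (continuous_fst.comp continuous_subtype_val)).inter (hB.preimage hc)
  obtain ⟨O, hO, hOS⟩ := isOpen_induced_iff.1 hS
  rw [isOpen_iff_mem_nhds]
  rintro _ ⟨a, ha, b, hb, h, rfl⟩
  have hmem : (a, comp a b h) ∈ O := by
    have : (⟨(a, comp a b h), (ran_comp a b h).symm⟩ : {p : G × G // ran p.1 = ran p.2}) ∈
        Subtype.val ⁻¹' O := by
      rw [hOS]
      refine ⟨ha, ?_⟩
      change comp (inv a) (comp a b h) _ ∈ B
      rw [inv_comp_cancel]
      exact hb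
    exact this
  obtain ⟨A', B', hA', hB', haA', hB'm, hsub⟩ := isOpen_prod_iff.1 hO _ _ hmem
  have hopen : IsOpen (B' ∩ ranUnits ⁻¹' (ranUnits '' A')) :=
    hB'.inter ((isOpenMap_ranUnits _ hA').preimage continuous_ranUnits)
  refine Filter.mem_of_superset
    (hopen.mem_nhds ⟨hB'm, a, haA', Subtype.ext (ran_comp a b h).symm⟩) ?_
  rintro g ⟨hg, a', ha', he⟩
  have hr : ran a' = ran g := congrArg Subtype.val he
  have hm : (⟨(a', g), hr⟩ : {p : G × G // ran p.1 = ran p.2}) ∈ Subtype.val ⁻¹' O :=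
    hsub (show (a', g) ∈ A' ×ˢ B' from ⟨ha', hg⟩)
  rw [hOS] at hm
  exact ⟨a', hm.1, _, hm.2, _, comp_inv_cancel_left a' g hr⟩

theorem isCompact_setComp {A B : Set G} (hA : IsCompact A) (hB : IsCompact B) :
    IsCompact (setComp A B) := by
  have := t2_units (G := G)
  have hcl : IsClosed {p : G × G | dom p.1 = ran p.2} := by
    have : {p : G × G | dom p.1 = ran p.2} =
        {p : G × G | domUnits p.1 = ranUnits p.2} := by
      ext p
      exact ⟨fun h => Subtype.ext h, fun h => congrArg Subtype.val h⟩
    rw [this]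
    exact isClosed_eq (continuous_domUnits.comp continuous_fst)
      (continuous_ranUnits.comp continuous_snd)
  have hK := (hcl.isClosedEmbedding_subtypeVal.isCompact_preimage (hA.prod hB)).image
    (continuous_comp (G := G))
  convert hK using 1
  ext g
  constructor
  · rintro ⟨a, ha, b, hb, h, rfl⟩
    exact ⟨⟨(a, b), h⟩, ⟨ha, hb⟩, rfl⟩
  · rintro ⟨⟨⟨a, b⟩, h⟩, ⟨ha, hb⟩, rfl⟩
    exact ⟨a, ha, b, hb, h, rfl⟩

theorem isEmbedding_restrict {U : Set G} (hU : IsOpen U) {φ : G → units G} (hc : Continuous φ)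
    (ho : IsOpenMap φ) (hi : ∀ a ∈ U, ∀ b ∈ U, φ a = φ b → a = b) :
    IsEmbedding (U.domRestrict fun g => (φ g : G)) := by
  have h : IsOpenEmbedding (φ ∘ ((↑) : U → G)) :=
    .of_continuous_injective_isOpenMap (hc.comp continuous_subtype_val)
      (fun a b h => Subtype.ext (hi _ a.2 _ b.2 h)) (ho.comp hU.isOpenMap_subtype_val)
  exact IsEmbedding.subtypeVal.comp h.isEmbedding

theorem isCompactLocalBisection_of_inj {U : Set G} (hU : IsOpen U) (hK : IsCompact U)
    (hd : ∀ a ∈ U, ∀ b ∈ U, dom a = dom b → a = b)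
    (hr : ∀ a ∈ U, ∀ b ∈ U, ran a = ran b → a = b) : IsCompactLocalBisection U :=
  ⟨hU, hK,
    isEmbedding_restrict hU continuous_domUnits isOpenMap_domUnits fun a ha b hb h =>
      hd a ha b hb (congrArg Subtype.val h),
    isEmbedding_restrict hU continuous_ranUnits isOpenMap_ranUnits fun a ha b hb h =>
      hr a ha b hb (congrArg Subtype.val h)⟩

end IsAmpleGroupoid

/-- In an ample groupoid the product of two compact local bisections is again one. -/
theorem IsCompactLocalBisection.setComp [IsAmpleGroupoid G] {U V : Set G}
    (hU : IsCompactLocalBisection U) (hV : IsCompactLocalBisection V) :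
    IsCompactLocalBisection (setComp U V) := by
  refine IsAmpleGroupoid.isCompactLocalBisection_of_inj
    (IsAmpleGroupoid.isOpen_setComp hU.isOpen hV.isOpen)
    (IsAmpleGroupoid.isCompact_setComp hU.isCompact hV.isCompact) ?_ ?_
  · rintro _ ⟨a, ha, b, hb, h, rfl⟩ _ ⟨a', ha', b', hb', h', rfl⟩ e
    rw [dom_comp, dom_comp] at e
    obtain rfl := hV.dom_inj hb hb' e
    obtain rfl := hU.dom_inj ha ha' (h.trans h'.symm)
    rfl
  · rintro _ ⟨a, ha, b, hb, h, rfl⟩ _ ⟨a', ha', b', hb', h', rfl⟩ e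
    rw [ran_comp, ran_comp] at e
    obtain rfl := hU.ran_inj ha ha' e
    obtain rfl := hV.ran_inj hb hb' (h.symm.trans h')
    rfl

end Topological

section Convolution

variable {K G : Type*} [CommRing K] [TopologicalSpace G] [ArrowGroupoid G]

theorem indicator_mem_steinbergSubmodule {U : Set G} (hU : IsCompactLocalBisection U) :
    (U.indicator 1 : G → K) ∈ steinbergSubmodule K G :=
  Submodule.subset_span ⟨U, hU, rfl⟩

theorem steinbergSubmodule_finite {f : G → K} (hf : f ∈ steinbergSubmodule K G) (x : G) :
    {a | ran a = x ∧ f a ≠ 0}.Finite := by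
  induction hf using Submodule.span_induction with
  | mem f hf =>
    obtain ⟨U, hU, rfl⟩ := hf
    refine Set.Subsingleton.finite fun a ha b hb => ?_
    exact hU.ran_inj (Set.mem_of_indicator_ne_zero ha.2) (Set.mem_of_indicator_ne_zero hb.2)
      (ha.1.trans hb.1.symm)
  | zero => simp
  | add f g _ _ hf hg =>
    refine (hf.union hg).subset fun a ha => ?_
    by_cases h : f a = 0
    · exact Or.inr ⟨ha.1, fun h' => ha.2 (by simp [h, h'])⟩
    · exact Or.inl ⟨ha.1, h⟩
  | smul c f _ hf =>
    exact hf.subset fun a ha => ⟨ha.1, fun h => ha.2 (by simp [h])⟩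

/-- The sums that define the convolution product are finite. -/
theorem convolution_finite {f : G → K} (hf : f ∈ steinbergSubmodule K G) (g : G → K) (γ : G) :
    (Function.support fun p : {p : G × G // ∃ h : dom p.1 = ran p.2, comp p.1 p.2 h = γ} =>
      f p.1.1 * g p.1.2).Finite := by
  refine Set.Finite.of_finite_image (f := fun p => p.1.1)
    ((steinbergSubmodule_finite hf (ran γ)).subset ?_) ?_
  · rintro _ ⟨⟨⟨a, b⟩, h, rfl⟩, hp, rfl⟩
    exact ⟨(ran_comp _ _ _).symm, left_ne_zero_of_mul hp⟩
  · rintro ⟨⟨a, b⟩, h, e⟩ _ ⟨⟨a', b'⟩, h', e'⟩ _ haa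
    obtain rfl : a = a' := haa
    obtain rfl := comp_left_cancel (e.trans e'.symm)
    rfl

theorem convolution_add_left {f f' : G → K} (hf : f ∈ steinbergSubmodule K G)
    (hf' : f' ∈ steinbergSubmodule K G) (g : G → K) :
    convolution (f + f') g = convolution f g + convolution f' g := by
  funext γ
  simp only [convolution, Pi.add_apply, add_mul]
  exact finsum_add_distrib (convolution_finite hf g γ) (convolution_finite hf' g γ)

theorem convolution_add_right {f : G → K} (hf : f ∈ steinbergSubmodule K G) (g g' : G → K) :
    convolution f (g + g') = convolution f g + convolution f g' := by
  funext γ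
  simp only [convolution, Pi.add_apply, mul_add]
  exact finsum_add_distrib (convolution_finite hf g γ) (convolution_finite hf g' γ)

theorem convolution_smul_left {f : G → K} (hf : f ∈ steinbergSubmodule K G) (c : K)
    (g : G → K) : convolution (c • f) g = c • convolution f g := by
  funext γ
  simp only [convolution, Pi.smul_apply, smul_mul_assoc]
  exact (smul_finsum' c (convolution_finite hf g γ)).symm

theorem convolution_smul_right {f : G → K} (hf : f ∈ steinbergSubmodule K G) (c : K)
    (g : G → K) : convolution f (c • g) = c • convolution f g := by
  funext γ
  simp only [convolution, Pi.smul_apply, mul_smul_comm]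
  exact (smul_finsum' c (convolution_finite hf g γ)).symm

theorem convolution_zero_left (g : G → K) : convolution (0 : G → K) g = 0 := by
  funext γ
  simp [convolution]

theorem convolution_zero_right (f : G → K) : convolution f (0 : G → K) = 0 := by
  funext γ
  simp [convolution]

theorem convolution_indicator_left {U : Set G} (hU : IsCompactLocalBisection U) (g : G → K)
    {a b : G} (ha : a ∈ U) (h : dom a = ran b) :
    convolution (U.indicator 1) g (comp a b h) = g b := by
  rw [convolution, finsum_eq_single _ ⟨(a, b), h, rfl⟩]
  · simp [ha]
  · rintro ⟨⟨a', b'⟩, h', e⟩ hne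
    by_cases ha' : a' ∈ U
    · refine absurd ?_ hne
      obtain rfl : a' = a :=
        hU.ran_inj ha' ha ((ran_comp _ _ h').symm.trans ((congrArg ran e).trans (ran_comp _ _ h)))
      obtain rfl := comp_left_cancel e
      rfl
    · simp [ha']

theorem convolution_indicator_right {V : Set G} (hV : IsCompactLocalBisection V) (f : G → K)
    {a b : G} (hb : b ∈ V) (h : dom a = ran b) :
    convolution f (V.indicator 1) (comp a b h) = f a := by
  rw [convolution, finsum_eq_single _ ⟨(a, b), h, rfl⟩]
  · simp [hb]
  · rintro ⟨⟨a', b'⟩, h', e⟩ hne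
    by_cases hb' : b' ∈ V
    · refine absurd ?_ hne
      obtain rfl : b' = b :=
        hV.dom_inj hb' hb ((dom_comp _ _ h').symm.trans ((congrArg dom e).trans (dom_comp _ _ h)))
      obtain rfl := comp_right_cancel e
      rfl
    · simp [hb']

theorem exists_of_convolution_ne_zero {f g : G → K} {γ : G} (h : convolution f g γ ≠ 0) :
    ∃ a b, ∃ hab : dom a = ran b, comp a b hab = γ ∧ f a ≠ 0 ∧ g b ≠ 0 := by
  obtain ⟨⟨⟨a, b⟩, hab, e⟩, hne⟩ := not_forall.1 fun h0 => h (finsum_eq_zero_of_forall_eq_zero h0)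
  exact ⟨a, b, hab, e, left_ne_zero_of_mul hne, right_ne_zero_of_mul hne⟩

theorem convolution_indicator {U V : Set G} (hU : IsCompactLocalBisection U) :
    convolution (U.indicator 1 : G → K) (V.indicator 1) = (setComp U V).indicator 1 := by
  classical
  funext γ
  by_cases h : γ ∈ setComp U V
  · rw [Set.indicator_of_mem h]
    obtain ⟨a, ha, b, hb, hab, rfl⟩ := h
    rw [convolution_indicator_left hU _ ha, Set.indicator_of_mem hb]
    rfl
  · rw [Set.indicator_of_notMem h]
    by_contra hne
    obtain ⟨a, b, hab, e, ha, hb⟩ := exists_of_convolution_ne_zero hne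
    exact h ⟨a, Set.mem_of_indicator_ne_zero ha, b, Set.mem_of_indicator_ne_zero hb, hab, e⟩

theorem convolution_mem [IsAmpleGroupoid G] {f g : G → K} (hf : f ∈ steinbergSubmodule K G)
    (hg : g ∈ steinbergSubmodule K G) : convolution f g ∈ steinbergSubmodule K G := by
  induction hf using Submodule.span_induction with
  | mem f hf =>
    obtain ⟨U, hU, rfl⟩ := hf
    induction hg using Submodule.span_induction with
    | mem g hg =>
      obtain ⟨V, hV, rfl⟩ := hg
      rw [convolution_indicator hU]
      exact indicator_mem_steinbergSubmodule (hU.setComp hV)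
    | zero => rw [convolution_zero_right]; exact zero_mem _
    | add g g' _ _ hg hg' =>
      rw [convolution_add_right (indicator_mem_steinbergSubmodule hU)]
      exact add_mem hg hg'
    | smul c g _ hg =>
      rw [convolution_smul_right (indicator_mem_steinbergSubmodule hU)]
      exact Submodule.smul_mem _ c hg
  | zero => rw [convolution_zero_left]; exact zero_mem _
  | add f f' hf hf' h h' =>
    rw [convolution_add_left hf hf']
    exact add_mem h h'
  | smul c f hf h =>
    rw [convolution_smul_left hf]
    exact Submodule.smul_mem _ c h

end Convolution

end Algebra

/-- The Steinberg algebra of `G` over `K`: the `K`-span of the characteristic functions of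
compact local bisections, with pointwise linear structure and the convolution product. -/
def SteinbergAlgebra (K G : Type*) [CommRing K] [TopologicalSpace G] [ArrowGroupoid G] : Type _ :=
  steinbergSubmodule K G

namespace SteinbergAlgebra

section Ring

variable {K G : Type*} [CommRing K] [TopologicalSpace G] [ArrowGroupoid G]

instance : AddCommGroup (SteinbergAlgebra K G) :=
  inferInstanceAs (AddCommGroup (steinbergSubmodule K G))

instance : Module K (SteinbergAlgebra K G) :=
  inferInstanceAs (Module K (steinbergSubmodule K G))

/-- An element of the Steinberg algebra as a function on the groupoid. -/
def toFun (f : SteinbergAlgebra K G) : G → K := f.1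

theorem toFun_mem (f : SteinbergAlgebra K G) : f.toFun ∈ steinbergSubmodule K G := f.2

theorem ext {f g : SteinbergAlgebra K G} (h : f.toFun = g.toFun) : f = g := Subtype.ext h

/-- The characteristic function of a compact local bisection. -/
noncomputable def char {U : Set G} (hU : IsCompactLocalBisection U) : SteinbergAlgebra K G :=
  ⟨U.indicator 1, indicator_mem_steinbergSubmodule hU⟩

theorem toFun_char {U : Set G} (hU : IsCompactLocalBisection U) :
    (char hU : SteinbergAlgebra K G).toFun = U.indicator 1 := rfl

theorem toFun_zero : (0 : SteinbergAlgebra K G).toFun = 0 := rfl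

theorem toFun_add (f g : SteinbergAlgebra K G) : (f + g).toFun = f.toFun + g.toFun := rfl

theorem toFun_neg (f : SteinbergAlgebra K G) : (-f).toFun = -f.toFun := rfl

theorem toFun_smul (c : K) (f : SteinbergAlgebra K G) : (c • f).toFun = c • f.toFun := rfl

theorem induction {P : SteinbergAlgebra K G → Prop} (f : SteinbergAlgebra K G)
    (char : ∀ (U : Set G) (hU : IsCompactLocalBisection U), P (char hU)) (zero : P 0)
    (add : ∀ f g, P f → P g → P (f + g)) (smul : ∀ (c : K) f, P f → P (c • f)) : P f := by
  obtain ⟨f, hf⟩ := f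
  induction hf using Submodule.span_induction with
  | mem f hf =>
    obtain ⟨U, hU, rfl⟩ := hf
    exact char U hU
  | zero => exact zero
  | add f g hf hg h h' => exact add _ _ h h'
  | smul c f hf h => exact smul c _ h

variable [IsAmpleGroupoid G]

noncomputable instance : Mul (SteinbergAlgebra K G) :=
  ⟨fun f g => ⟨convolution f.toFun g.toFun, convolution_mem f.2 g.2⟩⟩

theorem toFun_mul (f g : SteinbergAlgebra K G) :
    (f * g).toFun = convolution f.toFun g.toFun := rfl

theorem mul_add_aux (f g h : SteinbergAlgebra K G) : f * (g + h) = f * g + f * h :=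
  ext (convolution_add_right f.2 _ _)

theorem add_mul_aux (f g h : SteinbergAlgebra K G) : (f + g) * h = f * h + g * h :=
  ext (convolution_add_left f.2 g.2 _)

theorem smul_mul_aux (c : K) (f g : SteinbergAlgebra K G) : (c • f) * g = c • (f * g) :=
  ext (convolution_smul_left f.2 c _)

theorem mul_smul_aux (c : K) (f g : SteinbergAlgebra K G) : f * (c • g) = c • (f * g) :=
  ext (convolution_smul_right f.2 c _)

theorem zero_mul_aux (f : SteinbergAlgebra K G) : 0 * f = 0 :=
  ext (convolution_zero_left _)

theorem mul_zero_aux (f : SteinbergAlgebra K G) : f * 0 = 0 :=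
  ext (convolution_zero_right _)

theorem char_mul_char {U V : Set G} (hU : IsCompactLocalBisection U)
    (hV : IsCompactLocalBisection V) :
    (char hU * char hV : SteinbergAlgebra K G) = char (hU.setComp hV) :=
  ext (convolution_indicator hU)

theorem mul_assoc_aux (f g h : SteinbergAlgebra K G) : f * g * h = f * (g * h) := by
  induction f using induction with
  | zero => simp only [zero_mul_aux]
  | add f f' hf hf' => simp only [add_mul_aux, hf, hf']
  | smul c f hf => simp only [smul_mul_aux, hf]
  | char U hU =>
  induction g using induction with
  | zero => simp only [zero_mul_aux, mul_zero_aux]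
  | add f f' hf hf' => simp only [add_mul_aux, mul_add_aux, hf, hf']
  | smul c f hf => simp only [smul_mul_aux, mul_smul_aux, hf]
  | char V hV =>
  induction h using induction with
  | zero => simp only [mul_zero_aux]
  | add f f' hf hf' => simp only [mul_add_aux, hf, hf']
  | smul c f hf => simp only [mul_smul_aux, hf]
  | char W hW =>
  simp only [char_mul_char]
  refine ext ?_
  simp only [toFun_char, ArrowGroupoid.setComp_assoc]

noncomputable instance : NonUnitalRing (SteinbergAlgebra K G) where
  left_distrib := mul_add_aux
  right_distrib := add_mul_aux
  zero_mul := zero_mul_aux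
  mul_zero := mul_zero_aux
  mul_assoc := mul_assoc_aux

instance : IsScalarTower K (SteinbergAlgebra K G) (SteinbergAlgebra K G) :=
  ⟨fun c f g => smul_mul_aux c f g⟩

instance : SMulCommClass K (SteinbergAlgebra K G) (SteinbergAlgebra K G) :=
  ⟨fun c f g => (mul_smul_aux c f g).symm⟩

end Ring

/-- A function in the Steinberg algebra is singular if its support (no closure is taken) has empty
interior. -/
def IsSingular {K G : Type*} [CommRing K] [TopologicalSpace G] [ArrowGroupoid G]
    (f : SteinbergAlgebra K G) : Prop :=
  interior (Function.support f.toFun) = ∅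

section Singular

variable {K G : Type*} [CommRing K] [TopologicalSpace G] [ArrowGroupoid G]

theorem isSingular_iff {f : SteinbergAlgebra K G} :
    f.IsSingular ↔ ∀ W : Set G, IsOpen W → W ⊆ Function.support f.toFun → W = ∅ := by
  constructor
  · intro h W hW hs
    exact Set.subset_empty_iff.1 (h ▸ interior_maximal hs hW)
  · intro h
    exact h _ isOpen_interior interior_subset

theorem dense_locallyConstant (f : SteinbergAlgebra K G) :
    Dense {x | ∀ᶠ y in 𝓝 x, f.toFun y = f.toFun x} := by
  have hopen : ∀ f : SteinbergAlgebra K G,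
      IsOpen {x | ∀ᶠ y in 𝓝 x, f.toFun y = f.toFun x} := by
    intro f
    rw [isOpen_iff_mem_nhds]
    intro x hx
    filter_upwards [eventually_eventually_nhds.2 hx, hx] with y hy hyx
    filter_upwards [hy] with z hz
    rw [hz, hyx]
  induction f using induction with
  | zero =>
    exact dense_univ.mono fun _ _ => Filter.Eventually.of_forall fun _ => rfl
  | add f g hf hg =>
    refine (hf.inter_of_isOpen_left hg (hopen f)).mono ?_
    rintro x ⟨h, h'⟩
    filter_upwards [h, h'] with y hy hy'
    simp only [toFun_add, Pi.add_apply, hy, hy']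
  | smul c f hf =>
    refine hf.mono fun x h => ?_
    filter_upwards [h] with y hy
    simp only [toFun_smul, Pi.smul_apply, hy]
  | char U hU =>
    rw [dense_iff_inter_open]
    intro W hW hne
    by_cases h : (W ∩ U).Nonempty
    · obtain ⟨x, hxW, hxU⟩ := h
      refine ⟨x, hxW, ?_⟩
      filter_upwards [hU.isOpen.mem_nhds hxU] with y hy
      simp [toFun_char, hy, hxU]
    · obtain ⟨x, hx⟩ := hne
      refine ⟨x, hx, ?_⟩
      have key : ∀ y ∈ W, y ∉ U := fun y hy hyU => h ⟨y, hy, hyU⟩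
      filter_upwards [hW.mem_nhds hx] with y hy
      simp [toFun_char, key y hy, key x hx]

theorem isSingular_iff_dense {f : SteinbergAlgebra K G} :
    f.IsSingular ↔ Dense {x | ∀ᶠ y in 𝓝 x, f.toFun y = 0} := by
  constructor
  · intro h
    refine (dense_locallyConstant f).mono fun x hx => ?_
    by_cases h0 : f.toFun x = 0
    · filter_upwards [hx] with y hy
      rw [hy, h0]
    · exfalso
      have : x ∈ interior (Function.support f.toFun) := by
        rw [mem_interior_iff_mem_nhds]
        filter_upwards [hx] with y hy
        rw [Function.mem_support, hy]
        exact h0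
      rw [IsSingular] at h
      simp [h] at this
  · intro h
    rw [isSingular_iff]
    intro W hW hs
    by_contra hne
    obtain ⟨x, hxW, hx⟩ :=
      dense_iff_inter_open.1 h W hW (Set.nonempty_iff_ne_empty.2 hne)
    exact hs hxW hx.self_of_nhds

theorem isSingular_zero : (0 : SteinbergAlgebra K G).IsSingular := by
  simp [IsSingular, toFun_zero]

theorem IsSingular.add {f g : SteinbergAlgebra K G} (hf : f.IsSingular) (hg : g.IsSingular) :
    (f + g).IsSingular := by
  rw [isSingular_iff_dense] at *
  refine (hf.inter_of_isOpen_left hg isOpen_setOfPred_eventually_nhds).mono ?_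
  rintro x ⟨h, h'⟩
  filter_upwards [h, h'] with y hy hy'
  simp [toFun_add, hy, hy']

theorem IsSingular.smul {f : SteinbergAlgebra K G} (hf : f.IsSingular) (c : K) :
    (c • f).IsSingular := by
  rw [isSingular_iff_dense] at *
  refine hf.mono fun x h => ?_
  filter_upwards [h] with y hy
  simp [toFun_smul, hy]

theorem IsSingular.neg {f : SteinbergAlgebra K G} (hf : f.IsSingular) : (-f).IsSingular := by
  simpa using hf.smul (-1)

open ArrowGroupoid in
theorem IsSingular.mul_left [IsAmpleGroupoid G] (f : SteinbergAlgebra K G)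
    {g : SteinbergAlgebra K G} (hg : g.IsSingular) : (f * g).IsSingular := by
  induction f using induction with
  | zero => rw [zero_mul]; exact isSingular_zero
  | add f f' hf hf' => rw [add_mul]; exact hf.add hf'
  | smul c f hf => rw [smul_mul_assoc]; exact hf.smul c
  | char U hU =>
    rw [isSingular_iff] at *
    intro W hW hs
    have hW' := IsAmpleGroupoid.isOpen_setComp (IsAmpleGroupoid.isOpen_inv_image hU.isOpen) hW
    have hempty := hg _ hW' (by
      rintro _ ⟨_, ⟨u, hu, rfl⟩, w, hw, h, rfl⟩
      have hr : ran u = ran w := (dom_inv u).symm.trans h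
      have hne : convolution (U.indicator 1) g.toFun w ≠ 0 := hs hw
      rw [← comp_inv_cancel_left u w hr, convolution_indicator_left hU _ hu] at hne
      exact hne)
    by_contra hne
    obtain ⟨w, hw⟩ := Set.nonempty_iff_ne_empty.2 hne
    have hw0 : convolution (U.indicator 1) g.toFun w ≠ 0 := hs hw
    obtain ⟨u, b, h, rfl, hu, -⟩ := exists_of_convolution_ne_zero hw0
    have : comp (inv u) (comp u b h) ((dom_inv u).trans (ran_comp u b h).symm) ∈ (∅ : Set G) :=
      hempty ▸ ⟨_, ⟨u, Set.mem_of_indicator_ne_zero hu, rfl⟩, _, hw, _, rfl⟩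
    exact this

open ArrowGroupoid in
theorem IsSingular.mul_right [IsAmpleGroupoid G] {f : SteinbergAlgebra K G}
    (hf : f.IsSingular) (g : SteinbergAlgebra K G) : (f * g).IsSingular := by
  induction g using induction with
  | zero => rw [mul_zero]; exact isSingular_zero
  | add g g' hg hg' => rw [mul_add]; exact hg.add hg'
  | smul c g hg => rw [mul_smul_comm]; exact hg.smul c
  | char U hU =>
    rw [isSingular_iff] at *
    intro W hW hs
    have hW' := IsAmpleGroupoid.isOpen_setComp hW (IsAmpleGroupoid.isOpen_inv_image hU.isOpen)
    have hempty := hf _ hW' (by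
      rintro _ ⟨w, hw, _, ⟨u, hu, rfl⟩, h, rfl⟩
      have hne : convolution f.toFun (U.indicator 1) w ≠ 0 := hs hw
      have e := comp_inv_cancel w (inv u) h
      have hd : dom (comp w (inv u) h) = ran u := (dom_comp _ _ _).trans (dom_inv u)
      have e' : comp (comp w (inv u) h) u hd = w := by
        refine Eq.trans ?_ e
        congr 1
        exact (ArrowGroupoid.inv_inv u).symm
      rw [← e', convolution_indicator_right hU _ hu] at hne
      exact hne)
    by_contra hne
    obtain ⟨w, hw⟩ := Set.nonempty_iff_ne_empty.2 hne
    have hw0 : convolution f.toFun (U.indicator 1) w ≠ 0 := hs hw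
    obtain ⟨a, u, h, rfl, -, hu⟩ := exists_of_convolution_ne_zero hw0
    have : comp (comp a u h) (inv u) ((dom_comp a u h).trans (ran_inv u).symm) ∈ (∅ : Set G) :=
      hempty ▸ ⟨_, hw, _, ⟨u, Set.mem_of_indicator_ne_zero hu, rfl⟩, _, rfl⟩
    exact this

end Singular

end SteinbergAlgebra

/-- The singular ideal: the two-sided ideal of the Steinberg algebra that consists of the singular
functions. -/
noncomputable def singularIdeal (K G : Type*) [CommRing K] [TopologicalSpace G] [ArrowGroupoid G]
    [IsAmpleGroupoid G] : TwoSidedIdeal (SteinbergAlgebra K G) :=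
  TwoSidedIdeal.mk' {f | f.IsSingular} SteinbergAlgebra.isSingular_zero
    (fun hf hg => hf.add hg) (fun hf => hf.neg) (fun {f _} hg => hg.mul_left f)
    (fun {_ g} hf => hf.mul_right g)

theorem mem_singularIdeal {K G : Type*} [CommRing K] [TopologicalSpace G] [ArrowGroupoid G]
    [IsAmpleGroupoid G] (f : SteinbergAlgebra K G) : f ∈ singularIdeal K G ↔ f.IsSingular :=
  TwoSidedIdeal.mem_mk' _ _ _ _ _ _ _

/-! For (1), a singular function that is nonzero over `K` is carried down to one over `F`. Since `K`
is a ℚ-vector space, a ℚ-linear functional `φ : K → ℚ` can be chosen so that `φ ∘ f` is nonzero at a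
given point of the support of `f`. Composing with `φ` and then clearing denominators gives a nonzero
integer-valued function in the Steinberg algebra over ℤ, with support inside that of `f`. Dividing
out powers of `p` makes some value prime to `p`, and reduction mod `p` then gives a nonzero singular
function over `F`.

The division is the crux: an integral combination of bisections all of whose values are divisible by
`p` must be `p` times another such combination (`mem_ideal_smul_of_forall_mem`). This is not formal,
because the bisections may overlap and `G` need not be Hausdorff, so their intersections need not be
compact. The proof refines the combination inside one bisection at a time, where the topology is
Hausdorff.

For (2), simplicity over one field forces conditions on `G` alone: it is nonempty, effective
(`subset_units_of_isSimpleRing`) and minimal (`exists_arrow_of_isSimpleRing`). It also forces the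
singular ideal over that field to vanish. By (1) the singular ideal vanishes over `K` too, and these
properties together imply simplicity (`isSimpleRing_of_effective_of_minimal`). -/

open ArrowGroupoid

/-! ### Compact local bisections: set operations inside a bisection, and the basis they form. -/

section Topological

variable {G : Type*} [TopologicalSpace G] [ArrowGroupoid G] [IsAmpleGroupoid G]

namespace IsCompactLocalBisection

/-- Compact open subsets of a compact local bisection are compact local bisections. -/
theorem mono {U V : Set G} (hU : IsCompactLocalBisection U) (hV : IsOpen V) (hK : IsCompact V)
    (h : V ⊆ U) : IsCompactLocalBisection V :=
  IsAmpleGroupoid.isCompactLocalBisection_of_inj hV hK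
    (fun _ ha _ hb e => hU.dom_inj (h ha) (h hb) e) (fun _ ha _ hb e => hU.ran_inj (h ha) (h hb) e)

/-- The domain map embeds `U` in the Hausdorff unit space. This local separation replaces the
Hausdorff property that `G` may lack. -/
theorem t2Space {U : Set G} (hU : IsCompactLocalBisection U) : T2Space U := by
  have := IsAmpleGroupoid.t2_units (G := G)
  refine T2Space.of_injective_continuous (f := fun u : U => domUnits u.1) ?_
    (IsAmpleGroupoid.continuous_domUnits.comp continuous_subtype_val)
  intro a b h
  exact Subtype.ext (hU.dom_inj a.2 b.2 (congrArg Subtype.val h))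

/-- The ambient bisection `U` is Hausdorff, so the compact set `W` is closed in it. Without a common
`U`, the difference could fail to be open or compact. -/
theorem diff {U V W : Set G} (hU : IsCompactLocalBisection U) (hV : IsCompactLocalBisection V)
    (hW : IsCompactLocalBisection W) (hVU : V ⊆ U) (hWU : W ⊆ U) :
    IsCompactLocalBisection (V \ W) := by
  have := hU.t2Space
  have hcomp : ∀ A ⊆ U, IsCompact A → IsCompact ((↑) ⁻¹' A : Set U) := by
    intro A hA hK
    rw [IsInducing.subtypeVal.isCompact_iff, Subtype.image_preimage_coe,
      Set.inter_eq_right.2 hA]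
    exact hK
  have e : (Subtype.val '' (((↑) ⁻¹' V : Set U) \ (↑) ⁻¹' W)) = V \ W := by
    ext g
    constructor
    · rintro ⟨u, hu, rfl⟩
      exact hu
    · intro hg
      exact ⟨⟨g, hVU hg.1⟩, hg, rfl⟩
  have hWo : IsOpen ((↑) ⁻¹' W : Set U) := hW.isOpen.preimage continuous_subtype_val
  have hWc : IsClosed ((↑) ⁻¹' W : Set U) := (hcomp W hWU hW.isCompact).isClosed
  refine hU.mono ?_ ?_ (Set.sdiff_subset.trans hVU)
  · rw [← e]
    exact hU.isOpen.isOpenMap_subtype_val _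
      ((hV.isOpen.preimage continuous_subtype_val).sdiff hWc)
  · rw [← e]
    exact ((hcomp V hVU hV.isCompact).diff hWo).image continuous_subtype_val

theorem inter {U V W : Set G} (hU : IsCompactLocalBisection U) (hV : IsCompactLocalBisection V)
    (hW : IsCompactLocalBisection W) (hVU : V ⊆ U) (hWU : W ⊆ U) :
    IsCompactLocalBisection (V ∩ W) := by
  rw [← Set.sdiff_sdiff_right_self]
  exact hU.diff hV (hU.diff hV hW hVU hWU) hVU (Set.sdiff_subset.trans hVU)

theorem union {U V W : Set G} (hU : IsCompactLocalBisection U) (hV : IsCompactLocalBisection V)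
    (hW : IsCompactLocalBisection W) (hVU : V ⊆ U) (hWU : W ⊆ U) :
    IsCompactLocalBisection (V ∪ W) :=
  hU.mono (hV.isOpen.union hW.isOpen) (hV.isCompact.union hW.isCompact) (Set.union_subset hVU hWU)

theorem empty : IsCompactLocalBisection (∅ : Set G) :=
  IsAmpleGroupoid.isCompactLocalBisection_of_inj isOpen_empty isCompact_empty (by simp) (by simp)

theorem inv_image {U : Set G} (hU : IsCompactLocalBisection U) :
    IsCompactLocalBisection (inv '' U) := by
  refine IsAmpleGroupoid.isCompactLocalBisection_of_inj
    (IsAmpleGroupoid.isOpen_inv_image hU.isOpen)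
    (hU.isCompact.image IsAmpleGroupoid.continuous_inv) ?_ ?_
  · rintro _ ⟨a, ha, rfl⟩ _ ⟨b, hb, rfl⟩ h
    rw [dom_inv, dom_inv] at h
    rw [hU.ran_inj ha hb h]
  · rintro _ ⟨a, ha, rfl⟩ _ ⟨b, hb, rfl⟩ h
    rw [ran_inv, ran_inv] at h
    rw [hU.dom_inj ha hb h]

end IsCompactLocalBisection

namespace IsAmpleGroupoid

theorem exists_isOpen_dom_injOn (g : G) :
    ∃ O : Set G, IsOpen O ∧ g ∈ O ∧ ∀ a ∈ O, ∀ b ∈ O, dom a = dom b → a = b := by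
  obtain ⟨e, hg, he⟩ := isLocalHomeomorph_dom (G := G) g
  refine ⟨e.source, e.open_source, hg, fun a ha b hb h => e.injOn ha hb ?_⟩
  rw [← he]
  exact Subtype.ext h

/-- The compact local bisections form a basis of the topology. -/
theorem exists_isCompactLocalBisection {O : Set G} (hO : IsOpen O) {g : G} (hg : g ∈ O) :
    ∃ U, IsCompactLocalBisection U ∧ g ∈ U ∧ U ⊆ O := by
  obtain ⟨e, hge, he⟩ := isLocalHomeomorph_dom (G := G) g
  -- Injectivity of the domain map near `inv g` is injectivity of the range map near `g`.
  obtain ⟨Q, hQ, hgQ, hQi⟩ := exists_isOpen_dom_injOn (inv g)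
  set O' := O ∩ e.source ∩ inv ⁻¹' Q with hO'
  have hO'o : IsOpen O' := (hO.inter e.open_source).inter (hQ.preimage continuous_inv)
  have hgO' : g ∈ O' := ⟨⟨hg, hge⟩, hgQ⟩
  have hinj : ∀ a ∈ O', ∀ b ∈ O', dom a = dom b → a = b := by
    intro a ha b hb h
    refine e.injOn ha.1.2 hb.1.2 ?_
    rw [← he]
    exact Subtype.ext h
  obtain ⟨B, ⟨hBo, hBc⟩, hgB, hB⟩ := basis_units.exists_subset_of_mem_open
    (Set.mem_image_of_mem domUnits hgO') (isOpenMap_domUnits _ hO'o)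
  -- The right side is visibly open; the left side is a continuous image of the compact set `B`.
  have hV : e.symm '' B = O' ∩ domUnits ⁻¹' B := by
    have hsymm : ∀ a ∈ O', e.symm (domUnits a) = a := by
      intro a ha
      rw [he]
      exact e.left_inv ha.1.2
    ext a
    constructor
    · rintro ⟨b, hb, rfl⟩
      obtain ⟨o, ho, rfl⟩ := hB hb
      rw [hsymm o ho]
      exact ⟨ho, hb⟩
    · rintro ⟨ha, hb⟩
      exact ⟨_, hb, hsymm a ha⟩
  refine ⟨O' ∩ domUnits ⁻¹' B, isCompactLocalBisection_of_inj
    (hO'o.inter (hBo.preimage continuous_domUnits)) ?_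
    (fun a ha b hb => hinj a ha.1 b hb.1) ?_, ⟨hgO', hgB⟩, fun a ha => ha.1.1.1⟩
  · rw [← hV]
    refine hBc.image_of_continuousOn (e.continuousOn_symm.mono fun b hb => ?_)
    obtain ⟨o, ho, rfl⟩ := hB hb
    rw [he]
    exact e.map_source ho.1.2
  · intro a ha b hb h
    have := hQi _ ha.1.2 _ hb.1.2 (by rw [dom_inv, dom_inv, h])
    rw [← ArrowGroupoid.inv_inv a, this, ArrowGroupoid.inv_inv]

end IsAmpleGroupoid

end Topological

/-! ### Divisibility: elements of the Steinberg algebra with values in an ideal of the coefficient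
ring. -/

section Divisibility

theorem indicator_const_eq_smul {R G : Type*} [CommRing R] (A : Set G) (c : R) :
    A.indicator (fun _ => c) = c • (A.indicator 1 : G → R) := by
  ext γ
  by_cases h : γ ∈ A <;> simp [h]

variable {R G : Type*} [CommRing R] [TopologicalSpace G] [ArrowGroupoid G]

theorem indicator_const_mem_ideal_smul (N : Ideal R) {A : Set G} (hA : IsCompactLocalBisection A)
    {c : R} (hc : c ∈ N) : A.indicator (fun _ => c) ∈ N • steinbergSubmodule R G := by
  rw [indicator_const_eq_smul]
  exact Submodule.smul_mem_smul hc (indicator_mem_steinbergSubmodule hA)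

variable [IsAmpleGroupoid G]

open Classical in
/-- If a combination of bisections takes values in an ideal, then one of the bisections can be
removed by shrinking the others, at the cost of a combination with coefficients in the ideal. -/
theorem exists_subset_indicator_add_sum_mem (N : Ideal R) {ι : Type*} (s : Finset ι)
    (n : ι → R) (U : ι → Set G) (hU : ∀ i ∈ s, IsCompactLocalBisection (U i)) (c : R) {V : Set G}
    (hV : IsCompactLocalBisection V)
    (h : ∀ γ ∈ V, c + ∑ i ∈ s, (U i).indicator (fun _ => n i) γ ∈ N) :
    ∃ B : ι → Set G, (∀ i ∈ s, IsCompactLocalBisection (B i) ∧ B i ⊆ U i) ∧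
      V.indicator (fun _ => c) + ∑ i ∈ s, (B i).indicator (fun _ => n i) ∈
        N • steinbergSubmodule R G := by
  -- Compactness induction on `V`, with a statement that passes to all smaller bisections `W`.
  -- Together with `B i ⊆ W` this allows local solutions to be glued along a disjoint decomposition.
  -- The redundant `V ∩ V` is the instance `A = V` of the induction predicate.
  have key : ∃ V', IsCompactLocalBisection V' ∧ V ∩ V ⊆ V' ∧ V' ⊆ V ∧
      ∀ W ⊆ V', IsCompactLocalBisection W → ∃ B : ι → Set G,
      (∀ i ∈ s, IsCompactLocalBisection (B i) ∧ B i ⊆ U i ∧ B i ⊆ W) ∧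
      W.indicator (fun _ => c) + ∑ i ∈ s, (B i).indicator (fun _ => n i) ∈
        N • steinbergSubmodule R G := by
    refine hV.isCompact.induction_on (p := fun A => ∃ V', IsCompactLocalBisection V' ∧
      V ∩ A ⊆ V' ∧ V' ⊆ V ∧ ∀ W ⊆ V', IsCompactLocalBisection W → ∃ B : ι → Set G,
      (∀ i ∈ s, IsCompactLocalBisection (B i) ∧ B i ⊆ U i ∧ B i ⊆ W) ∧
      W.indicator (fun _ => c) + ∑ i ∈ s, (B i).indicator (fun _ => n i) ∈
        N • steinbergSubmodule R G) ?_ ?_ ?_ ?_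
    · refine ⟨∅, .empty, by simp, by simp, fun W hW _ => ⟨fun _ => ∅, ?_, ?_⟩⟩
      · exact fun i _ => ⟨.empty, Set.empty_subset _, Set.empty_subset _⟩
      · convert (N • steinbergSubmodule R G).zero_mem using 1
        ext
        simp [Set.subset_empty_iff.1 hW]
    · rintro A A' hA ⟨V', h1, h2, h3⟩
      exact ⟨V', h1, (Set.inter_subset_inter_right V hA).trans h2, h3⟩
    · rintro A A' ⟨V₁, hV₁, hA₁, hV₁V, H₁⟩ ⟨V₂, hV₂, hA₂, hV₂V, H₂⟩
      refine ⟨V₁ ∪ V₂, hV.union hV₁ hV₂ hV₁V hV₂V, ?_, Set.union_subset hV₁V hV₂V, ?_⟩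
      · rw [Set.inter_union_distrib_left]
        exact Set.union_subset_union hA₁ hA₂
      intro W hW hWb
      have hWV : W ⊆ V := hW.trans (Set.union_subset hV₁V hV₂V)
      -- `W` is cut into the disjoint pieces `W ∩ V₁` and `W \ V₁`, so that indicators of unions are
      -- sums.
      obtain ⟨B₁, hB₁, hs₁⟩ := H₁ (W ∩ V₁) Set.inter_subset_right (hV.inter hWb hV₁ hWV hV₁V)
      obtain ⟨B₂, hB₂, hs₂⟩ := H₂ (W \ V₁) (fun γ hγ => (hW hγ.1).resolve_left hγ.2)
        (hV.diff hWb hV₁ hWV hV₁V)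
      have hdisj : Disjoint (W ∩ V₁) (W \ V₁) :=
        Set.disjoint_left.2 fun γ hγ hγ' => hγ'.2 hγ.2
      refine ⟨fun i => B₁ i ∪ B₂ i, fun i hi => ?_, ?_⟩
      · obtain ⟨a, b, d⟩ := hB₁ i hi
        obtain ⟨a', b', d'⟩ := hB₂ i hi
        exact ⟨(hU i hi).union a a' b b', Set.union_subset b b',
          Set.union_subset (d.trans Set.inter_subset_left) (d'.trans Set.sdiff_subset)⟩
      · convert add_mem hs₁ hs₂ using 1
        have e1 : W.indicator (fun _ => c) =
            (W ∩ V₁).indicator (fun _ => c) + (W \ V₁).indicator (fun _ => c) := by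
          exact (congrArg (Set.indicator · _) (Set.inter_union_sdiff W V₁).symm).trans
            (Set.indicator_union_of_disjoint hdisj _)
        have e2 : ∀ i ∈ s, (B₁ i ∪ B₂ i).indicator (fun _ => n i) =
            (B₁ i).indicator (fun _ => n i) + (B₂ i).indicator (fun _ => n i) := fun i hi =>
          Set.indicator_union_of_disjoint
            (hdisj.mono (hB₁ i hi).2.2 (hB₂ i hi).2.2) _
        rw [e1, Finset.sum_congr rfl e2, Finset.sum_add_distrib]
        abel
    · intro γ hγ
      have hopen : IsOpen (V ∩ ⋂ i ∈ s.filter (γ ∈ U ·), U i) :=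
        hV.isOpen.inter (isOpen_biInter_finset fun i hi => (hU i (Finset.mem_filter.1 hi).1).isOpen)
      obtain ⟨V', hV', hγV', hsub⟩ := IsAmpleGroupoid.exists_isCompactLocalBisection hopen
        (g := γ) ⟨hγ, by simp⟩
      refine ⟨V', mem_nhdsWithin_of_mem_nhds (hV'.isOpen.mem_nhds hγV'), V', hV',
        Set.inter_subset_right, hsub.trans Set.inter_subset_left, fun W hW hWb => ?_⟩
      -- Since `W` lies in every `U i` containing `γ`, this choice makes the combination constant on
      -- `W`, equal to its value at `γ`, which is in `N`.
      refine ⟨fun i => if γ ∈ U i then W else ∅, fun i hi => ?_, ?_⟩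
      · by_cases hi' : γ ∈ U i
        · simp only [hi', if_true]
          refine ⟨hWb, fun x hx => ?_, subset_rfl⟩
          exact Set.mem_iInter₂.1 (hsub (hW hx)).2 i (Finset.mem_filter.2 ⟨hi, hi'⟩)
        · simp only [hi', if_false]
          exact ⟨.empty, Set.empty_subset _, Set.empty_subset _⟩
      · convert indicator_const_mem_ideal_smul N hWb (h γ hγ) using 1
        ext x
        by_cases hx : x ∈ W
        · simp only [Pi.add_apply, Finset.sum_apply, Set.indicator_of_mem hx]
          congr 1
          refine Finset.sum_congr rfl fun i _ => ?_
          by_cases hi' : γ ∈ U i <;> simp [hi', hx]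
        · simp only [Pi.add_apply, Finset.sum_apply, Set.indicator_of_notMem hx, zero_add]
          refine Finset.sum_eq_zero fun i _ => ?_
          by_cases hi' : γ ∈ U i <;> simp [hi', hx]
  obtain ⟨V', hV', h1, h2, H⟩ := key
  obtain rfl : V' = V := h2.antisymm (by simpa using h1)
  obtain ⟨B, hB, hs⟩ := H V' subset_rfl hV
  exact ⟨B, fun i hi => ⟨(hB i hi).1, (hB i hi).2.1⟩, hs⟩

/-- Induction on the number of bisections. Each `U i` splits into `B i`, which is absorbed together
with `U j` into an element of `N • steinbergSubmodule R G`, and `U i \ B i`. The absorbed part has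
values in `N`, so the remaining sum does too, and it has one term fewer. -/
theorem sum_indicator_mem_ideal_smul (N : Ideal R) {ι : Type*} (s : Finset ι) (n : ι → R)
    (U : ι → Set G) (hU : ∀ i ∈ s, IsCompactLocalBisection (U i))
    (h : ∀ γ, ∑ i ∈ s, (U i).indicator (fun _ => n i) γ ∈ N) :
    ∑ i ∈ s, (U i).indicator (fun _ => n i) ∈ N • steinbergSubmodule R G := by
  classical
  induction s using Finset.induction_on generalizing U with
  | empty => simp
  | insert j s hj ih =>
    have hUs : ∀ i ∈ s, IsCompactLocalBisection (U i) := fun i hi =>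
      hU i (Finset.mem_insert_of_mem hi)
    simp only [Finset.sum_insert hj] at h ⊢
    obtain ⟨B, hB, hs⟩ := exists_subset_indicator_add_sum_mem N s n U hUs (n j)
      (hU j (Finset.mem_insert_self _ _)) (fun γ hγ => by simpa [hγ] using h γ)
    have hval : ∀ f ∈ N • steinbergSubmodule R G, ∀ γ, f γ ∈ N := by
      intro f hf γ
      refine Submodule.smul_induction_on hf (fun r hr f _ => ?_) (fun f g hf hg => ?_)
      · exact N.mul_mem_right _ hr
      · exact N.add_mem hf hg
    have e : ∀ i ∈ s, (U i).indicator (fun _ => n i) =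
        (B i).indicator (fun _ => n i) + (U i \ B i).indicator (fun _ => n i) := by
      intro i hi
      exact (congrArg (Set.indicator · _) (Set.union_sdiff_cancel (hB i hi).2).symm).trans
        (Set.indicator_union_of_disjoint Set.disjoint_sdiff_right _)
    have esum : (U j).indicator (fun _ => n j) + ∑ i ∈ s, (U i).indicator (fun _ => n i) =
        ((U j).indicator (fun _ => n j) + ∑ i ∈ s, (B i).indicator (fun _ => n i)) +
          ∑ i ∈ s, (U i \ B i).indicator (fun _ => n i) := by
      rw [Finset.sum_congr rfl e, Finset.sum_add_distrib, add_assoc]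
    rw [esum]
    refine add_mem hs (ih (fun i => U i \ B i) (fun i hi => ?_) fun γ => ?_)
    · exact (hUs i hi).diff (hUs i hi) (hB i hi).1 subset_rfl (hB i hi).2
    · have h1 := h γ
      have h2 := congrFun esum γ
      have h3 := hval _ hs γ
      rw [Pi.add_apply, Finset.sum_apply, Pi.add_apply, Finset.sum_apply] at h2
      rw [h2] at h1
      exact (N.add_mem_iff_right h3).1 h1

/-- A function in the Steinberg algebra with values in an ideal `N` is a combination of
characteristic functions with coefficients in `N`. -/
theorem mem_ideal_smul_of_forall_mem (N : Ideal R) {f : G → R} (hf : f ∈ steinbergSubmodule R G)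
    (h : ∀ γ, f γ ∈ N) : f ∈ N • steinbergSubmodule R G := by
  obtain ⟨m, c, g, rfl⟩ := Submodule.mem_span_set'.1 hf
  choose U hU hg using fun i => (g i).2
  have e : ∀ i, c i • (g i : G → R) = (U i).indicator (fun _ => c i) := fun i => by
    rw [indicator_const_eq_smul, hg i]
  simp only [e] at h ⊢
  exact sum_indicator_mem_ideal_smul N _ c U (fun i _ => hU i) (by simpa using h)

end Divisibility

/-! ### Change of coefficients and descent of singular functions. -/

section CoefficientChange

variable {G : Type*} [TopologicalSpace G] [ArrowGroupoid G]

/-- Additivity of `φ` is enough, because a scalar `c` can be absorbed by replacing `φ` with `φ (c *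
·)`; hence `φ` varies in the induction. This covers both a ℚ-linear functional on a field and the
map from ℤ to a field. -/
theorem comp_mem_steinbergSubmodule {R S : Type*} [CommRing R] [CommRing S] {f : G → R}
    (hf : f ∈ steinbergSubmodule R G) (φ : R →+ S) : φ ∘ f ∈ steinbergSubmodule S G := by
  induction hf using Submodule.span_induction generalizing φ with
  | mem f hf =>
    obtain ⟨U, hU, rfl⟩ := hf
    have e : φ ∘ (U.indicator 1) = φ 1 • (U.indicator 1 : G → S) := by
      ext γ
      by_cases h : γ ∈ U <;> simp [h]
    rw [e]
    exact Submodule.smul_mem _ _ (indicator_mem_steinbergSubmodule hU)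
  | zero =>
    have e : φ ∘ (0 : G → R) = 0 := by ext; simp
    rw [e]
    exact zero_mem _
  | add f g _ _ hf hg =>
    have e : φ ∘ (f + g) = φ ∘ f + φ ∘ g := by ext; simp
    rw [e]
    exact add_mem (hf φ) (hg φ)
  | smul c f _ hf =>
    exact hf (φ.comp (AddMonoidHom.mulLeft c))

theorem exists_smul_eq_intCast {f : G → ℚ} (hf : f ∈ steinbergSubmodule ℚ G) :
    ∃ m : ℤ, m ≠ 0 ∧ ∃ g ∈ steinbergSubmodule ℤ G, ∀ γ, m * f γ = g γ := by
  induction hf using Submodule.span_induction with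
  | mem f hf =>
    obtain ⟨U, hU, rfl⟩ := hf
    refine ⟨1, one_ne_zero, _, indicator_mem_steinbergSubmodule hU, fun γ => ?_⟩
    by_cases h : γ ∈ U <;> simp [h]
  | zero => exact ⟨1, one_ne_zero, 0, zero_mem _, by simp⟩
  | add f g _ _ hf hg =>
    obtain ⟨m, hm, f', hf', e⟩ := hf
    obtain ⟨m', hm', g', hg', e'⟩ := hg
    refine ⟨m * m', mul_ne_zero hm hm', m' • f' + m • g',
      add_mem (Submodule.smul_mem _ _ hf') (Submodule.smul_mem _ _ hg'), fun γ => ?_⟩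
    simp only [Pi.add_apply, Pi.smul_apply, smul_eq_mul]
    push_cast
    rw [← e, ← e']
    ring
  | smul c f _ hf =>
    obtain ⟨m, hm, g, hg, e⟩ := hf
    refine ⟨m * c.den, mul_ne_zero hm (by exact_mod_cast c.den_ne_zero), c.num • g,
      Submodule.smul_mem _ _ hg, fun γ => ?_⟩
    have hc : (c.den : ℚ) * c = c.num := by rw [mul_comm, Rat.mul_den_eq_num]
    simp only [Pi.smul_apply, smul_eq_mul]
    push_cast
    rw [← e, ← hc]
    ring

variable [IsAmpleGroupoid G]

/-- Dividing by the largest possible power of `p`. -/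
theorem exists_not_dvd_of_ne_zero {p : ℕ} (hp : 1 < p) {f : G → ℤ}
    (hf : f ∈ steinbergSubmodule ℤ G) {γ : G} (hγ : f γ ≠ 0) :
    ∃ g ∈ steinbergSubmodule ℤ G, Function.support g = Function.support f ∧
      ∃ γ, ¬ (p : ℤ) ∣ g γ := by
  -- Division by `p` preserves the support and strictly decreases the nonzero integer `|f γ|`, so it
  -- must stop.
  induction hk : (f γ).natAbs using Nat.strong_induction_on generalizing f with
  | _ k ih =>
  by_cases h : ∀ γ, (p : ℤ) ∣ f γ
  · have h1 := mem_ideal_smul_of_forall_mem (Ideal.span {(p : ℤ)}) hf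
      fun γ => Ideal.mem_span_singleton.2 (h γ)
    rw [Submodule.ideal_span_singleton_smul, Submodule.mem_smul_pointwise_iff_exists] at h1
    obtain ⟨g, hg, rfl⟩ := h1
    have hg0 : g γ ≠ 0 := fun h0 => hγ (by simp [h0])
    obtain ⟨g', hg', hs, hn⟩ := ih (g γ).natAbs (by
      rw [← hk, Pi.smul_apply, smul_eq_mul, Int.natAbs_mul, Int.natAbs_natCast]
      have := Int.natAbs_pos.2 hg0
      nlinarith) hg hg0 rfl
    refine ⟨g', hg', hs.trans ?_, hn⟩
    ext x
    simp [show p ≠ 0 by omega]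
  · exact ⟨f, hf, rfl, not_forall.1 h⟩

/-- If the singular ideal vanishes over some field of positive characteristic, then it vanishes
over all fields of characteristic zero. -/
theorem singularIdeal_eq_bot_of_charP {F K : Type*} [Field F] [Field K] [CharZero K] (p : ℕ)
    (hp : 0 < p) [CharP F p] (h : singularIdeal F G = ⊥) : singularIdeal K G = ⊥ := by
  have hp1 : 1 < p := lt_of_le_of_ne hp (CharP.char_ne_one F p).symm
  rw [eq_bot_iff]
  intro f hf
  rw [mem_singularIdeal] at hf
  rw [TwoSidedIdeal.mem_bot]
  by_contra hne
  obtain ⟨γ, hγ⟩ : ∃ γ, f.toFun γ ≠ 0 := by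
    by_contra! h0
    exact hne (SteinbergAlgebra.ext (funext h0))
  -- Linear functionals separate the points of the ℚ-vector space `K`.
  obtain ⟨φ, hφ⟩ : ∃ φ : Module.Dual ℚ K, φ (f.toFun γ) ≠ 0 := by
    by_contra! h0
    exact hγ ((Module.forall_dual_apply_eq_zero_iff ℚ _).1 h0)
  obtain ⟨m, hm, g, hg, e⟩ :=
    exists_smul_eq_intCast (comp_mem_steinbergSubmodule f.toFun_mem φ.toAddMonoidHom)
  have hgγ : g γ ≠ 0 := by
    intro h0
    have := e γ
    rw [h0] at this
    simp [hm] at this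
    exact hφ this
  have hgs : Function.support g ⊆ Function.support f.toFun := by
    intro x hx h0
    refine hx ?_
    have := e x
    simpa [h0] using this.symm
  obtain ⟨g', hg', hs, x, hx⟩ := exists_not_dvd_of_ne_zero hp1 hg hgγ
  -- Reduction of `g'` mod `p`: its support can only shrink, so it stays singular, while its value
  -- at `x` survives.
  let q : SteinbergAlgebra F G :=
    ⟨_, comp_mem_steinbergSubmodule hg' (Int.castAddHom F)⟩
  have hq : q.IsSingular := by
    refine Set.subset_empty_iff.1 (hf ▸ interior_mono fun y hy => hgs (hs ▸ fun h0 => hy ?_))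
    change ((g' y : ℤ) : F) = 0
    simp [h0]
  rw [← mem_singularIdeal, h, TwoSidedIdeal.mem_bot] at hq
  have hqx : ((g' x : ℤ) : F) = 0 := congrFun (congrArg SteinbergAlgebra.toFun hq) x
  exact hx ((CharP.intCast_eq_zero_iff F p _).1 hqx)

end CoefficientChange

/-! ### The unit space inside the groupoid. -/

section Units

variable {G : Type*} [ArrowGroupoid G]

theorem ArrowGroupoid.dom_eq_self {x : G} (hx : x ∈ units G) : dom x = x := by
  obtain ⟨g, rfl⟩ := hx
  exact dom_dom g

theorem ArrowGroupoid.ran_eq_self {x : G} (hx : x ∈ units G) : ran x = x := by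
  obtain ⟨g, rfl⟩ := hx
  exact ran_dom g

theorem ArrowGroupoid.dom_mem_units (g : G) : dom g ∈ units G := ⟨g, rfl⟩

theorem ArrowGroupoid.comp_unit {a x : G} (hx : x ∈ units G) (h : dom a = ran x) :
    comp a x h = a := by
  obtain rfl : dom a = x := h.trans (ran_eq_self hx)
  exact comp_dom a

theorem ArrowGroupoid.unit_comp {x a : G} (hx : x ∈ units G) (h : dom x = ran a) :
    comp x a h = a := by
  obtain rfl : x = ran a := (dom_eq_self hx).symm.trans h
  exact ran_comp_self a

theorem ArrowGroupoid.setComp_units_right (A : Set G) {W : Set G} (hW : W ⊆ units G) :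
    setComp A W = {a ∈ A | dom a ∈ W} := by
  ext g
  constructor
  · rintro ⟨a, ha, x, hx, h, rfl⟩
    rw [comp_unit (hW hx)]
    exact ⟨ha, by rwa [h, ran_eq_self (hW hx)]⟩
  · rintro ⟨ha, hd⟩
    exact ⟨g, ha, _, hd, (ran_dom g).symm, comp_dom g⟩

theorem ArrowGroupoid.setComp_units_left {W : Set G} (hW : W ⊆ units G) (A : Set G) :
    setComp W A = {a ∈ A | ran a ∈ W} := by
  ext g
  constructor
  · rintro ⟨x, hx, a, ha, h, rfl⟩
    rw [unit_comp (hW hx)]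
    exact ⟨ha, by rwa [← h, dom_eq_self (hW hx)]⟩
  · rintro ⟨ha, hr⟩
    exact ⟨_, hr, g, ha, dom_ran g, ran_comp_self g⟩

theorem ArrowGroupoid.dom_image_subset_units (A : Set G) : dom '' A ⊆ units G := by
  rintro _ ⟨a, -, rfl⟩
  exact dom_mem_units a

variable [TopologicalSpace G] [IsAmpleGroupoid G]

/-- If `g` and `dom g` both lie in an open set on which the domain map is injective, they have the
same domain and so coincide. -/
theorem IsAmpleGroupoid.isOpen_units : IsOpen (units G) := by
  rw [isOpen_iff_mem_nhds]
  intro x hx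
  obtain ⟨O, hO, hxO, hinj⟩ := exists_isOpen_dom_injOn x
  refine Filter.mem_of_superset ((hO.inter (hO.preimage continuous_dom)).mem_nhds
    ⟨hxO, by rwa [Set.mem_preimage, dom_eq_self hx]⟩) ?_
  rintro g ⟨hg, hg'⟩
  exact ⟨g, hinj _ hg' _ hg (dom_dom g)⟩

theorem IsAmpleGroupoid.isOpen_dom_image {A : Set G} (hA : IsOpen A) : IsOpen (dom '' A) := by
  have h := isOpen_units.isOpenMap_subtype_val _ (isOpenMap_domUnits _ hA)
  rwa [Set.image_image] at h

theorem isCompactLocalBisection_of_subset_units {W : Set G} (hW : IsOpen W) (hK : IsCompact W)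
    (h : W ⊆ units G) : IsCompactLocalBisection W := by
  refine IsAmpleGroupoid.isCompactLocalBisection_of_inj hW hK ?_ ?_
  · intro a ha b hb e
    rwa [dom_eq_self (h ha), dom_eq_self (h hb)] at e
  · intro a ha b hb e
    rwa [ran_eq_self (h ha), ran_eq_self (h hb)] at e

theorem IsCompactLocalBisection.dom_image {U : Set G} (hU : IsCompactLocalBisection U) :
    IsCompactLocalBisection (dom '' U) :=
  isCompactLocalBisection_of_subset_units (IsAmpleGroupoid.isOpen_dom_image hU.isOpen)
    (hU.isCompact.image IsAmpleGroupoid.continuous_dom) (dom_image_subset_units U)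

theorem IsAmpleGroupoid.exists_disjoint_isOpen {x y : G} (hx : x ∈ units G) (hy : y ∈ units G)
    (h : x ≠ y) : ∃ A B : Set G, IsOpen A ∧ IsOpen B ∧ x ∈ A ∧ y ∈ B ∧ Disjoint A B := by
  have := t2_units (G := G)
  obtain ⟨A, B, hA, hB, hxA, hyB, hAB⟩ := t2_separation
    (show (⟨x, hx⟩ : units G) ≠ ⟨y, hy⟩ from fun e => h (congrArg Subtype.val e))
  refine ⟨Subtype.val '' A, Subtype.val '' B, isOpen_units.isOpenMap_subtype_val _ hA,
    isOpen_units.isOpenMap_subtype_val _ hB, ⟨_, hxA, rfl⟩, ⟨_, hyB, rfl⟩, ?_⟩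
  exact (Set.disjoint_image_iff Subtype.val_injective).2 hAB

end Units

namespace SteinbergAlgebra

variable {K G : Type*} [TopologicalSpace G] [ArrowGroupoid G]

/-! ### Consequences of simplicity: effectiveness, minimality, no singular functions. -/

section ArrowSum

variable [CommRing K]

/-- The sum of the values of a function over all arrows from `y` to `x`. -/
noncomputable def arrowSum (f : G → K) (x y : G) : K :=
  ∑ᶠ γ ∈ {γ | ran γ = x ∧ dom γ = y}, f γ

theorem arrowSum_add {f g : G → K} (hf : f ∈ steinbergSubmodule K G)
    (hg : g ∈ steinbergSubmodule K G) (x y : G) :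
    arrowSum (f + g) x y = arrowSum f x y + arrowSum g x y :=
  finsum_mem_add_distrib' ((steinbergSubmodule_finite hf x).subset fun _ h => ⟨h.1.1, h.2⟩)
    ((steinbergSubmodule_finite hg x).subset fun _ h => ⟨h.1.1, h.2⟩)

theorem arrowSum_smul {f : G → K} (hf : f ∈ steinbergSubmodule K G) (c : K) (x y : G) :
    arrowSum (c • f) x y = c * arrowSum f x y :=
  ((AddMonoidHom.mulLeft c).map_finsum_mem'
    ((steinbergSubmodule_finite hf x).subset fun _ h => ⟨h.1.1, h.2⟩)).symm

omit [TopologicalSpace G] in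
theorem arrowSum_zero (x y : G) : arrowSum (0 : G → K) x y = 0 := by
  simp [arrowSum]

theorem arrowSum_indicator {U : Set G} (hU : IsCompactLocalBisection U) {u : G} (hu : u ∈ U) :
    arrowSum (U.indicator 1 : G → K) (ran u) (dom u) = 1 := by
  rw [arrowSum, finsum_eq_single _ u]
  · simp [hu]
  · intro γ hγ
    by_cases h : γ ∈ U
    · have h' : ¬ (ran γ = ran u ∧ dom γ = dom u) := fun h' => hγ (hU.ran_inj h hu h'.1)
      simp [h']
    · simp [h]

omit [TopologicalSpace G] in
theorem arrowSum_indicator_eq_zero {U : Set G} {x y : G}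
    (h : ∀ u ∈ U, ran u = x → dom u ≠ y) : arrowSum (U.indicator 1 : G → K) x y = 0 :=
  finsum_mem_eq_zero_of_forall_eq_zero fun γ hγ =>
    Set.indicator_of_notMem (fun hU => h γ hU hγ.1 hγ.2) _

-- Left translation by the inverse of the unique `u ∈ U` with range `x` matches the arrows from `y`
-- to `x` with those from `y` to `dom u`; if there is no such `u`, all terms vanish.
open Classical in
theorem arrowSum_convolution_indicator_left {U : Set G} (hU : IsCompactLocalBisection U)
    {g : G → K} (hg : ∀ x y, arrowSum g x y = 0) (x y : G) :
    arrowSum (convolution (U.indicator 1) g) x y = 0 := by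
  by_cases h : ∃ u ∈ U, ran u = x
  · obtain ⟨u, hu, rfl⟩ := h
    rw [← hg (dom u) y]
    -- The `else` branch only makes the map total; it is never reached on the arrows being summed.
    refine (finsum_mem_eq_of_bijOn (fun γ => if h : dom (inv u) = ran γ then comp (inv u) γ h else γ)
      ⟨?_, ?_, ?_⟩ ?_)
    · rintro γ ⟨h1, h2⟩
      simp only [dom_inv, h1, dite_true]
      exact ⟨(ran_comp _ _ _).trans (ran_inv u), (dom_comp _ _ _).trans h2⟩
    · rintro γ ⟨h1, h2⟩ γ' ⟨h1', h2'⟩ e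
      simp only [dom_inv, h1, h1', dite_true] at e
      exact comp_left_cancel e
    · rintro γ ⟨h1, h2⟩
      refine ⟨comp u γ h1.symm, ⟨ran_comp _ _ _, (dom_comp _ _ _).trans h2⟩, ?_⟩
      simp only [dom_inv, ran_comp, dite_true]
      exact inv_comp_cancel u γ h1.symm
    · rintro γ ⟨h1, h2⟩
      simp only [dom_inv, h1, dite_true]
      conv_lhs => rw [← comp_inv_cancel_left u γ h1.symm]
      exact convolution_indicator_left hU g hu _
  · refine finsum_mem_eq_zero_of_forall_eq_zero fun γ hγ => ?_
    by_contra hne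
    obtain ⟨a, b, hab, rfl, ha, -⟩ := exists_of_convolution_ne_zero hne
    exact h ⟨a, Set.mem_of_indicator_ne_zero ha, (ran_comp _ _ _).symm.trans hγ.1⟩

open Classical in
theorem arrowSum_convolution_indicator_right {U : Set G} (hU : IsCompactLocalBisection U)
    {g : G → K} (hg : ∀ x y, arrowSum g x y = 0) (x y : G) :
    arrowSum (convolution g (U.indicator 1)) x y = 0 := by
  by_cases h : ∃ u ∈ U, dom u = y
  · obtain ⟨u, hu, rfl⟩ := h
    rw [← hg x (ran u)]
    refine (finsum_mem_eq_of_bijOn (fun γ => if h : dom γ = ran u then comp γ u h else γ)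
      ⟨?_, ?_, ?_⟩ ?_).symm
    · rintro γ ⟨h1, h2⟩
      simp only [h2, dite_true]
      exact ⟨(ran_comp _ _ _).trans h1, dom_comp _ _ _⟩
    · rintro γ ⟨h1, h2⟩ γ' ⟨h1', h2'⟩ e
      simp only [h2, h2', dite_true] at e
      exact comp_right_cancel e
    · rintro γ ⟨h1, h2⟩
      have hd : dom γ = ran (inv u) := h2.trans (ran_inv u).symm
      have hd' : dom (comp γ (inv u) hd) = ran u := (dom_comp _ _ _).trans (dom_inv u)
      refine ⟨comp γ (inv u) hd, ⟨(ran_comp _ _ _).trans h1, hd'⟩, ?_⟩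
      simp only [hd', dite_true]
      refine Eq.trans ?_ (comp_inv_cancel γ (inv u) hd)
      congr 1
      exact (ArrowGroupoid.inv_inv u).symm
    · rintro γ ⟨h1, h2⟩
      simp only [h2, dite_true]
      exact (convolution_indicator_right hU g hu _).symm
  · refine finsum_mem_eq_zero_of_forall_eq_zero fun γ hγ => ?_
    by_contra hne
    obtain ⟨a, b, hab, rfl, -, hb⟩ := exists_of_convolution_ne_zero hne
    exact h ⟨b, Set.mem_of_indicator_ne_zero hb, (dom_comp _ _ _).symm.trans hγ.2⟩

variable [IsAmpleGroupoid G]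

variable (K G) in
/-- The kernel of the action of the Steinberg algebra on functions on the unit space. -/
noncomputable def augmentationKernel : TwoSidedIdeal (SteinbergAlgebra K G) :=
  TwoSidedIdeal.mk' {f | ∀ x y, arrowSum f.toFun x y = 0}
    (fun x y => arrowSum_zero x y)
    (fun {f g} hf hg x y => by
      rw [toFun_add, arrowSum_add f.toFun_mem g.toFun_mem, hf, hg, add_zero])
    (fun {f} hf x y => by
      have e : (-f).toFun = (-1 : K) • f.toFun := by rw [toFun_neg, neg_one_smul]
      rw [e, arrowSum_smul f.toFun_mem, hf, mul_zero])
    (fun {f g} hg => by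
      induction f using induction with
      | zero => rw [zero_mul]; exact fun x y => arrowSum_zero x y
      | add f f' hf hf' =>
        intro x y
        rw [add_mul, toFun_add, arrowSum_add (toFun_mem _) (toFun_mem _), hf, hf', add_zero]
      | smul c f hf =>
        intro x y
        rw [smul_mul_assoc, toFun_smul, arrowSum_smul (toFun_mem _), hf, mul_zero]
      | char U hU => exact arrowSum_convolution_indicator_left hU hg)
    (fun {g f} hg => by
      induction f using induction with
      | zero => rw [mul_zero]; exact fun x y => arrowSum_zero x y
      | add f f' hf hf' =>
        intro x y
        rw [mul_add, toFun_add, arrowSum_add (toFun_mem _) (toFun_mem _), hf, hf', add_zero]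
      | smul c f hf =>
        intro x y
        rw [mul_smul_comm, toFun_smul, arrowSum_smul (toFun_mem _), hf, mul_zero]
      | char U hU => exact arrowSum_convolution_indicator_right hU hg)

theorem mem_augmentationKernel {f : SteinbergAlgebra K G} :
    f ∈ augmentationKernel K G ↔ ∀ x y, arrowSum f.toFun x y = 0 :=
  TwoSidedIdeal.mem_mk' _ _ _ _ _ _ _

theorem char_ne_zero [Nontrivial K] {U : Set G} (hU : IsCompactLocalBisection U)
    (hne : U.Nonempty) : (char hU : SteinbergAlgebra K G) ≠ 0 := by
  obtain ⟨u, hu⟩ := hne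
  intro h
  have := congrFun (congrArg toFun h) u
  simp [toFun_char, toFun_zero, hu] at this

variable (K) in
/-- If the Steinberg algebra is simple, then the groupoid is effective. -/
theorem subset_units_of_isSimpleRing [Nontrivial K] [IsSimpleRing (SteinbergAlgebra K G)]
    {U : Set G} (hU : IsCompactLocalBisection U) (h : ∀ u ∈ U, dom u = ran u) :
    U ⊆ units G := by
  intro u hu
  -- A bisection of isotropy arrows acts on functions on the units exactly as its set of domains
  -- does. If the kernel is zero, the two sets are equal; the kernel cannot be everything, since
  -- `char hU` has an arrow sum equal to 1.
  have hmem : (char hU + (-1 : K) • char hU.dom_image : SteinbergAlgebra K G) ∈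
      augmentationKernel K G := by
    rw [mem_augmentationKernel]
    intro x y
    rw [toFun_add, toFun_smul, arrowSum_add (toFun_mem _) (Submodule.smul_mem _ _ (toFun_mem _)),
      arrowSum_smul (toFun_mem _), toFun_char, toFun_char]
    by_cases hxy : ∃ v ∈ U, ran v = x ∧ dom v = y
    · obtain ⟨v, hv, rfl, rfl⟩ := hxy
      have h2 := arrowSum_indicator (K := K) hU.dom_image (Set.mem_image_of_mem dom hv)
      rw [ran_dom, dom_dom] at h2
      rw [arrowSum_indicator hU hv, ← h v hv, h2]
      ring
    · push Not at hxy
      rw [arrowSum_indicator_eq_zero hxy, arrowSum_indicator_eq_zero]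
      · ring
      · rintro _ ⟨v, hv, rfl⟩ e1 e2
        rw [ran_dom, h v hv] at e1
        rw [dom_dom] at e2
        exact hxy v hv e1 e2
  rcases eq_bot_or_eq_top (augmentationKernel K G) with hb | ht
  · rw [hb, TwoSidedIdeal.mem_bot, neg_one_smul, add_neg_eq_zero] at hmem
    have := congrFun (congrArg toFun hmem) u
    rw [toFun_char, toFun_char, Set.indicator_of_mem hu] at this
    exact dom_image_subset_units U
      (Set.mem_of_indicator_ne_zero (f := (1 : G → K)) (by rw [← this]; exact one_ne_zero))
  · have hU' : (char hU : SteinbergAlgebra K G) ∈ augmentationKernel K G := by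
      rw [ht]; exact TwoSidedIdeal.mem_top _
    have := mem_augmentationKernel.1 hU' (ran u) (dom u)
    rw [toFun_char, arrowSum_indicator hU hu] at this
    exact absurd this one_ne_zero

variable (K) in
/-- If the Steinberg algebra is simple, then the groupoid is minimal. -/
theorem exists_arrow_of_isSimpleRing [Nontrivial K] [IsSimpleRing (SteinbergAlgebra K G)]
    {V : Set G} (hV : IsCompactLocalBisection V) (hVu : V ⊆ units G) (hne : V.Nonempty)
    {x : G} (hx : x ∈ units G) : ∃ a, ran a = x ∧ dom a ∈ V := by
  -- `S` is the saturation of `V`. Its invariance under arrows makes the functions supported on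
  -- arrows with range in `S` a two-sided ideal `J`, which is nonzero because it contains `char hV`.
  let S : Set G := {x | ∃ a, ran a = x ∧ dom a ∈ V}
  let J : TwoSidedIdeal (SteinbergAlgebra K G) :=
    TwoSidedIdeal.mk' {f | ∀ γ, f.toFun γ ≠ 0 → ran γ ∈ S}
      (fun γ h => absurd rfl h)
      (fun {f g} hf hg γ h => by
        by_cases h0 : f.toFun γ = 0
        · refine hg γ fun h1 => h ?_
          rw [toFun_add, Pi.add_apply, h0, h1, add_zero]
        · exact hf γ h0)
      (fun {f} hf γ h => hf γ fun h0 => h (by rw [toFun_neg, Pi.neg_apply, h0, neg_zero]))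
      (fun {f g} hg γ h => by
        obtain ⟨a, b, hab, rfl, -, hb⟩ := exists_of_convolution_ne_zero h
        obtain ⟨c, hc, hcV⟩ := hg b hb
        exact ⟨comp a c (hab.trans hc.symm), (ran_comp _ _ _).trans (ran_comp _ _ _).symm,
          by rwa [dom_comp]⟩)
      (fun {f g} hf γ h => by
        obtain ⟨a, b, hab, rfl, ha, -⟩ := exists_of_convolution_ne_zero h
        rw [ran_comp]
        exact hf a ha)
  have hJ : ∀ f, f ∈ J ↔ ∀ γ, f.toFun γ ≠ 0 → ran γ ∈ S := fun f =>
    TwoSidedIdeal.mem_mk' _ _ _ _ _ _ _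
  have hVJ : char hV ∈ J := by
    rw [hJ]
    intro γ hγ
    have hγV : γ ∈ V := Set.mem_of_indicator_ne_zero hγ
    exact ⟨γ, rfl, by rwa [dom_eq_self (hVu hγV)]⟩
  have htop : J = ⊤ := by
    refine (eq_bot_or_eq_top J).resolve_left fun hb => ?_
    rw [hb, TwoSidedIdeal.mem_bot] at hVJ
    exact char_ne_zero hV hne hVJ
  obtain ⟨W, hW, hxW, -⟩ := IsAmpleGroupoid.exists_isCompactLocalBisection isOpen_univ
    (Set.mem_univ x)
  have hWJ : char hW ∈ J := by rw [htop]; exact TwoSidedIdeal.mem_top _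
  have := (hJ _).1 hWJ x (by rw [toFun_char, Set.indicator_of_mem hxW]; exact one_ne_zero)
  rwa [ran_eq_self hx] at this

theorem nonempty_of_isSimpleRing [IsSimpleRing (SteinbergAlgebra K G)] : Nonempty G := by
  by_contra h
  rw [not_nonempty_iff] at h
  obtain ⟨I, J, hIJ⟩ := exists_pair_ne (TwoSidedIdeal (SteinbergAlgebra K G))
  refine hIJ (TwoSidedIdeal.ext fun f => ?_)
  obtain rfl : f = 0 := ext (funext fun γ => h.elim γ)
  exact ⟨fun _ => J.zero_mem, fun _ => I.zero_mem⟩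

/-- The singular ideal is proper, since the characteristic function of a nonempty bisection has
nonempty open support. -/
theorem singularIdeal_eq_bot_of_isSimpleRing [Nontrivial K]
    [IsSimpleRing (SteinbergAlgebra K G)] : singularIdeal K G = ⊥ := by
  refine (eq_bot_or_eq_top _).resolve_right fun ht => ?_
  obtain ⟨x⟩ := nonempty_of_isSimpleRing (K := K) (G := G)
  obtain ⟨W, hW, hxW, -⟩ := IsAmpleGroupoid.exists_isCompactLocalBisection isOpen_univ
    (Set.mem_univ x)
  have hWS : (char hW : SteinbergAlgebra K G) ∈ singularIdeal K G := by
    rw [ht]; exact TwoSidedIdeal.mem_top _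
  rw [mem_singularIdeal, isSingular_iff] at hWS
  have hempty := hWS W hW.isOpen fun y hy => by simp [toFun_char, hy]
  rw [hempty] at hxW
  exact hxW

end ArrowSum

/-! ### Simplicity from effectiveness, minimality and the absence of singular functions. -/

section Simplicity

variable [IsAmpleGroupoid G]

/-- In an effective groupoid, a bisection becomes trivial after cutting down to a small set of
units. -/
theorem exists_subset_forall_setComp (heff : ∀ U : Set G, IsCompactLocalBisection U →
      (∀ u ∈ U, dom u = ran u) → U ⊆ units G)
    {U V : Set G} (hU : IsCompactLocalBisection U) (hV : IsOpen V)
    (hne : V.Nonempty) :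
    ∃ V' ⊆ V, IsCompactLocalBisection V' ∧ V'.Nonempty ∧
      ((∀ u ∈ U, ran u ∈ V' → dom u ∉ V') ∨
        V' ⊆ U ∧ ∀ u ∈ U, ran u ∈ V' → dom u ∈ V' → u ∈ V') := by
  by_cases h : ∃ u ∈ U, dom u ∈ V ∧ dom u ≠ ran u
  · obtain ⟨u, hu, huV, hne⟩ := h
    -- An arrow of `U` with distinct ends moves a small neighbourhood of its domain, inside `A`,
    -- into the disjoint set `B`.
    obtain ⟨A, B, hA, hB, huA, huB, hAB⟩ := IsAmpleGroupoid.exists_disjoint_isOpen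
      (dom_mem_units u) (ran_mem_units u) hne
    have hO : IsOpen (U ∩ dom ⁻¹' (A ∩ V) ∩ ran ⁻¹' B) :=
      (hU.isOpen.inter ((hA.inter hV).preimage IsAmpleGroupoid.continuous_dom)).inter
        (hB.preimage IsAmpleGroupoid.continuous_ran)
    obtain ⟨V', hV', huV', hsub⟩ := IsAmpleGroupoid.exists_isCompactLocalBisection
      (IsAmpleGroupoid.isOpen_dom_image hO) (Set.mem_image_of_mem dom ⟨⟨hu, huA, huV⟩, huB⟩)
    refine ⟨V', fun x hx => ?_, hV', ⟨_, huV'⟩, Or.inl fun v hv hr hd => ?_⟩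
    · obtain ⟨o, ho, rfl⟩ := hsub hx
      exact ho.1.2.2
    · obtain ⟨o, ho, e⟩ := hsub hd
      obtain rfl := hU.dom_inj ho.1.1 hv e
      obtain ⟨o', ho', e'⟩ := hsub hr
      refine Set.disjoint_left.1 hAB ?_ ho.2
      rw [← e']
      exact ho'.1.2.1
  · push Not at h
    by_cases hex : ∃ u ∈ U, dom u ∈ V
    · obtain ⟨u, hu, huV⟩ := hex
      obtain ⟨V', hV', huV', hsub⟩ := IsAmpleGroupoid.exists_isCompactLocalBisection
        (hU.isOpen.inter (hV.preimage IsAmpleGroupoid.continuous_dom)) (g := u) ⟨hu, huV⟩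
      -- Now every arrow of `U` that starts in `V` is isotropy, so effectiveness turns `V'` into a
      -- set of units.
      have hV'u : V' ⊆ units G := heff V' hV' fun v hv => h v (hsub hv).1 (hsub hv).2
      refine ⟨V', fun v hv => ?_, hV', ⟨_, huV'⟩, Or.inr ⟨fun v hv => (hsub hv).1, ?_⟩⟩
      · rw [← dom_eq_self (hV'u hv)]
        exact (hsub hv).2
      · intro v hv _ hd
        rwa [hU.dom_inj hv (hsub hd).1 (dom_dom v).symm]
    · push Not at hex
      obtain ⟨x, hx⟩ := hne
      obtain ⟨V', hV', hxV', hsub⟩ := IsAmpleGroupoid.exists_isCompactLocalBisection hV hx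
      exact ⟨V', hsub, hV', ⟨x, hxV'⟩, Or.inl fun u hu _ hd => hex u hu (hsub hd)⟩

/-- Over a small enough set of units, compression by `char hW` turns `f` into a scalar: each
bisection in `f` contributes either 0 or 1. Since the conclusion holds for all smaller `W`, a sum is
handled by shrinking successively for each summand. -/
theorem exists_corner_eq_smul [CommRing K] (heff : ∀ U : Set G, IsCompactLocalBisection U →
      (∀ u ∈ U, dom u = ran u) → U ⊆ units G) (f : SteinbergAlgebra K G)
    {V : Set G} (hV : IsOpen V) (hVu : V ⊆ units G) (hne : V.Nonempty) :
    ∃ V' ⊆ V, IsOpen V' ∧ V'.Nonempty ∧ ∃ c : K,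
      ∀ (W : Set G) (hW : IsCompactLocalBisection W), W ⊆ V' →
        char hW * f * char hW = c • char hW := by
  induction f using induction generalizing V with
  | zero => exact ⟨V, subset_rfl, hV, hne, 0, fun W hW _ => by simp⟩
  | add f g hf hg =>
    obtain ⟨V₁, h1, h2, h3, c, hc⟩ := hf hV hVu hne
    obtain ⟨V₂, h1', h2', h3', c', hc'⟩ := hg h2 (h1.trans hVu) h3
    refine ⟨V₂, h1'.trans h1, h2', h3', c + c', fun W hW hs => ?_⟩
    rw [mul_add, add_mul, hc W hW (hs.trans h1'), hc' W hW hs, add_smul]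
  | smul a f hf =>
    obtain ⟨V₁, h1, h2, h3, c, hc⟩ := hf hV hVu hne
    refine ⟨V₁, h1, h2, h3, a * c, fun W hW hs => ?_⟩
    rw [mul_smul_comm, smul_mul_assoc, hc W hW hs, mul_smul]
  | char U hU =>
    obtain ⟨V', h1, h2, h3, h4⟩ := exists_subset_forall_setComp heff hU hV hne
    have hset : ∀ W ⊆ V', setComp (setComp W U) W = {u ∈ U | ran u ∈ W ∧ dom u ∈ W} := by
      intro W hW
      have hWu : W ⊆ units G := hW.trans (h1.trans hVu)
      rw [setComp_units_right _ hWu, setComp_units_left hWu]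
      ext u
      exact and_assoc
    rcases h4 with h4 | ⟨h4, h5⟩
    · refine ⟨V', h1, h2.isOpen, h3, 0, fun W hW hs => ?_⟩
      rw [char_mul_char, char_mul_char, zero_smul]
      refine ext ?_
      have : setComp (setComp W U) W = ∅ := by
        rw [hset W hs]
        exact Set.eq_empty_of_forall_notMem fun u hu => h4 u hu.1 (hs hu.2.1) (hs hu.2.2)
      rw [toFun_char, this, Set.indicator_empty]
      rfl
    · refine ⟨V', h1, h2.isOpen, h3, 1, fun W hW hs => ?_⟩
      rw [char_mul_char, char_mul_char, one_smul]
      refine ext ?_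
      have hu : ∀ w ∈ V', w ∈ units G := fun w hw => hVu (h1 hw)
      have : setComp (setComp W U) W = W := by
        rw [hset W hs]
        ext u
        constructor
        · rintro ⟨huU, hr, hd⟩
          rwa [← dom_eq_self (hu u (h5 u huU (hs hr) (hs hd)))]
        · intro huW
          refine ⟨h4 (hs huW), ?_, ?_⟩
          · rwa [ran_eq_self (hu u (hs huW))]
          · rwa [dom_eq_self (hu u (hs huW))]
      rw [toFun_char, toFun_char, this]

/-- A `TwoSidedIdeal` is not assumed closed under scalars, so the division by `c` is done by
multiplying with `c⁻¹ • char hW`, using that `char hW` is idempotent. -/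
theorem smul_mem_twoSidedIdeal [Field K] (I : TwoSidedIdeal (SteinbergAlgebra K G)) {W : Set G}
    (hW : IsCompactLocalBisection W) (hWu : W ⊆ units G) {c : K} (hc : c ≠ 0)
    (h : c • char hW ∈ I) : char hW ∈ I := by
  have := I.mul_mem_left (c⁻¹ • char hW) _ h
  rw [smul_mul_assoc, mul_smul_comm, smul_smul, inv_mul_cancel₀ hc, one_smul, char_mul_char] at this
  convert this using 1
  refine ext ?_
  rw [toFun_char, toFun_char, setComp_units_right _ hWu]
  congr 1
  ext w
  exact ⟨fun hw => ⟨hw, by rwa [dom_eq_self (hWu hw)]⟩, fun hw => hw.1⟩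

/-- A nonzero ideal contains the characteristic function of a nonempty compact open set of units,
if the groupoid is effective and there are no nonzero singular functions. -/
theorem exists_char_mem_of_ne_bot [Field K] (heff : ∀ U : Set G, IsCompactLocalBisection U →
      (∀ u ∈ U, dom u = ran u) → U ⊆ units G) (hsing : singularIdeal K G = ⊥)
    {I : TwoSidedIdeal (SteinbergAlgebra K G)} (hI : I ≠ ⊥) :
    ∃ (W : Set G) (hW : IsCompactLocalBisection W), W ⊆ units G ∧ W.Nonempty ∧ char hW ∈ I := by
  obtain ⟨f, hf, hf0⟩ : ∃ f ∈ I, f ≠ 0 := by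
    by_contra! h
    exact hI (eq_bot_iff.2 fun f hf => (TwoSidedIdeal.mem_bot _).2 (h f hf))
  have hns : ¬ f.IsSingular := by
    rwa [← mem_singularIdeal, hsing, TwoSidedIdeal.mem_bot]
  obtain ⟨w, hw⟩ := Set.nonempty_iff_ne_empty.2 hns
  obtain ⟨U, hU, hwU, hUs⟩ := IsAmpleGroupoid.exists_isCompactLocalBisection isOpen_interior hw
  -- Translation by the inverse of `U` moves the nonzero values of `f` on `U` to the units `dom ''
  -- U`.
  set g : SteinbergAlgebra K G := char hU.inv_image * f with hg
  have hgI : g ∈ I := I.mul_mem_left _ _ hf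
  have hgne : ∀ x ∈ dom '' U, g.toFun x ≠ 0 := by
    rintro _ ⟨u, hu, rfl⟩
    rw [hg, toFun_mul, ← inv_comp u, toFun_char,
      convolution_indicator_left hU.inv_image _ (Set.mem_image_of_mem inv hu)]
    exact interior_subset (hUs hu)
  obtain ⟨V, hVU, hV, ⟨x, hx⟩, c, hc⟩ := exists_corner_eq_smul heff g
    (IsAmpleGroupoid.isOpen_dom_image hU.isOpen) (dom_image_subset_units U)
    ⟨_, Set.mem_image_of_mem dom hwU⟩
  obtain ⟨W, hW, hxW, hWV⟩ := IsAmpleGroupoid.exists_isCompactLocalBisection hV hx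
  have hWu : W ⊆ units G := (hWV.trans hVU).trans (dom_image_subset_units U)
  have hxu := hWu hxW
  have hdr : dom x = ran x := by rw [dom_eq_self hxu, ran_eq_self hxu]
  -- Writing the unit `x` as `comp x x` and evaluating the compressed function there identifies the
  -- scalar with a nonzero value of `g`.
  have hcx : g.toFun x = c := by
    have h1 := congrFun (congrArg toFun (hc W hW hWV)) (comp x x hdr)
    rw [toFun_mul, toFun_char, convolution_indicator_right hW _ hxW] at h1
    have h2 : (char hW * g).toFun (comp x x hdr) = g.toFun x := by
      rw [toFun_mul, toFun_char, convolution_indicator_left hW _ hxW]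
    rw [comp_unit hxu] at h1 h2
    rw [← h2, h1]
    simp [toFun_smul, toFun_char, hxW]
  refine ⟨W, hW, hWu, ⟨x, hxW⟩, smul_mem_twoSidedIdeal I hW hWu (c := c) ?_ ?_⟩
  · rw [← hcx]
    exact hgne x (hVU (hWV hxW))
  · rw [← hc W hW hWV]
    exact I.mul_mem_right _ _ (I.mul_mem_left _ _ hgI)

/-- In a minimal groupoid, an ideal that contains the characteristic function of a nonempty compact
open set of units is the whole algebra. -/
theorem eq_top_of_char_mem [CommRing K] {I : TwoSidedIdeal (SteinbergAlgebra K G)} {V : Set G}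
    (hV : IsCompactLocalBisection V) (hVu : V ⊆ units G)
    (hmin : ∀ x ∈ units G, ∃ a, ran a = x ∧ dom a ∈ V) (hVI : char hV ∈ I) : I = ⊤ := by
  have hlocal : ∀ x ∈ units G, ∃ (W : Set G) (hW : IsCompactLocalBisection W), W ⊆ units G ∧
      x ∈ W ∧ char hW ∈ I := by
    intro x hx
    obtain ⟨a, rfl, ha⟩ := hmin x hx
    obtain ⟨U, hU, haU, hUs⟩ := IsAmpleGroupoid.exists_isCompactLocalBisection
      (hV.isOpen.preimage IsAmpleGroupoid.continuous_dom) (g := a) ha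
    -- Conjugating `V` by a bisection through `a` gives a set of units around `ran a`.
    have hmem := I.mul_mem_right _ (char hU.inv_image) (I.mul_mem_left (char hU) _ hVI)
    rw [char_mul_char, char_mul_char] at hmem
    refine ⟨_, _, ?_, ?_, hmem⟩
    · rintro _ ⟨_, ⟨u, hu, v, hv, h, rfl⟩, _, ⟨u', hu', rfl⟩, h', rfl⟩
      have hd : dom u = dom u' := by
        rw [h, ran_eq_self (hVu hv), ← dom_eq_self (hVu hv), ← dom_comp u v h, h', ran_inv]
      obtain rfl := hU.dom_inj hu hu' hd
      simp only [comp_unit (hVu hv), comp_inv]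
      exact ran_mem_units u
    · rw [setComp_units_right _ hVu]
      exact ⟨a, ⟨haU, ha⟩, _, ⟨a, haU, rfl⟩, (ran_inv a).symm, comp_inv a⟩
  have hcompact : ∀ A : Set G, IsCompact A → A ⊆ units G →
      ∃ (W : Set G) (hW : IsCompactLocalBisection W), W ⊆ units G ∧ A ⊆ W ∧ char hW ∈ I := by
    intro A hA hAu
    refine hA.induction_on (p := fun A => ∃ (W : Set G) (hW : IsCompactLocalBisection W),
      W ⊆ units G ∧ A ⊆ W ∧ char hW ∈ I) ?_ ?_ ?_ ?_
    · exact ⟨V, hV, hVu, Set.empty_subset _, hVI⟩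
    · rintro s t hst ⟨W, hW, h1, h2, h3⟩
      exact ⟨W, hW, h1, hst.trans h2, h3⟩
    · rintro s t ⟨W, hW, h1, h2, h3⟩ ⟨W', hW', h1', h2', h3'⟩
      have hun : W ∪ W' ⊆ units G := Set.union_subset h1 h1'
      refine ⟨W ∪ W', isCompactLocalBisection_of_subset_units (hW.isOpen.union hW'.isOpen)
        (hW.isCompact.union hW'.isCompact) hun, hun, Set.union_subset_union h2 h2', ?_⟩
      -- Inclusion–exclusion; on sets of units the product of characteristic functions is that of
      -- the intersection.
      have hmem := I.sub_mem (I.add_mem h3 h3') (I.mul_mem_left (char hW) _ h3')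
      rw [char_mul_char] at hmem
      convert hmem using 1
      refine ext (funext fun x => ?_)
      rw [sub_eq_add_neg, toFun_add, toFun_add, toFun_neg, toFun_char, toFun_char, toFun_char,
        toFun_char, setComp_units_right _ h1']
      by_cases hx : x ∈ W <;> by_cases hx' : x ∈ W'
      · simp [hx, hx', dom_eq_self (h1 hx)]
      all_goals simp [hx, hx']
      intro hd
      exact absurd (by rwa [dom_eq_self (h1 hx)] at hd) hx'
    · intro x hx
      obtain ⟨W, hW, h1, h2, h3⟩ := hlocal x (hAu hx)
      exact ⟨W, mem_nhdsWithin_of_mem_nhds (hW.isOpen.mem_nhds h2), W, hW, h1, subset_rfl, h3⟩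
  have hchar : ∀ (U : Set G) (hU : IsCompactLocalBisection U) (c : K), c • char hU ∈ I := by
    intro U hU c
    obtain ⟨W, hW, hWu, hs, hWI⟩ := hcompact _ hU.dom_image.isCompact (dom_image_subset_units U)
    -- Because `W` contains all domains of `U`, `char hW` is a right identity for `char hU`.
    have hmem := I.mul_mem_left (c • char hU) _ hWI
    rw [smul_mul_assoc, char_mul_char] at hmem
    convert hmem using 2
    refine ext ?_
    rw [toFun_char, toFun_char, setComp_units_right _ hWu]
    congr 1
    ext u
    exact ⟨fun hu => ⟨hu, hs (Set.mem_image_of_mem dom hu)⟩, fun hu => hu.1⟩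
  refine eq_top_iff.2 fun f _ => ?_
  -- All multiples are treated at once, since `I` is not assumed to be a `K`-subspace.
  have key : ∀ c : K, c • f ∈ I := by
    induction f using induction with
    | char U hU => exact hchar U hU
    | zero => intro c; rw [smul_zero]; exact I.zero_mem
    | add f g hf hg =>
      intro c
      rw [smul_add]
      exact I.add_mem (hf trivial c) (hg trivial c)
    | smul a f hf =>
      intro c
      rw [smul_smul]
      exact hf trivial _
  simpa using key 1

/-- Over a field, the Steinberg algebra of a nonempty, minimal and effective ample groupoid is
simple if there are no nonzero singular functions. -/
theorem isSimpleRing_of_effective_of_minimal [Field K] [Nonempty G]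
    (heff : ∀ U : Set G, IsCompactLocalBisection U → (∀ u ∈ U, dom u = ran u) → U ⊆ units G)
    (hmin : ∀ V : Set G, IsCompactLocalBisection V → V ⊆ units G → V.Nonempty →
      ∀ x ∈ units G, ∃ a, ran a = x ∧ dom a ∈ V)
    (hsing : singularIdeal K G = ⊥) : IsSimpleRing (SteinbergAlgebra K G) where
  simple :=
    { exists_pair_ne := by
        obtain ⟨x⟩ := ‹Nonempty G›
        obtain ⟨W, hW, hxW, -⟩ := IsAmpleGroupoid.exists_isCompactLocalBisection isOpen_univ
          (Set.mem_univ x)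
        refine ⟨⊥, ⊤, fun h => char_ne_zero (K := K) hW ⟨x, hxW⟩ ?_⟩
        rw [← TwoSidedIdeal.mem_bot, h]
        exact TwoSidedIdeal.mem_top _
      eq_bot_or_eq_top := fun I => by
        by_cases hI : I = ⊥
        · exact Or.inl hI
        obtain ⟨V, hV, hVu, hne, hVI⟩ := exists_char_mem_of_ne_bot heff hsing hI
        exact Or.inr (eq_top_of_char_mem hV hVu (hmin V hV hVu hne) hVI) }

end Simplicity

end SteinbergAlgebra

theorem corollaryc {G : Type*} [TopologicalSpace G] [ArrowGroupoid G] [IsAmpleGroupoid G]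
    {F : Type*} [Field F] (p : ℕ) (hp : 0 < p) [CharP F p] :
    (singularIdeal F G = ⊥ →
      ∀ (K : Type*) [Field K] [CharZero K], singularIdeal K G = ⊥) ∧
    (IsSimpleRing (SteinbergAlgebra F G) →
      ∀ (K : Type*) [Field K] [CharZero K], IsSimpleRing (SteinbergAlgebra K G)) := by
  refine ⟨fun h K _ _ => singularIdeal_eq_bot_of_charP p hp h, fun h K _ _ => ?_⟩
  have := SteinbergAlgebra.nonempty_of_isSimpleRing (K := F) (G := G)
  -- Effectiveness and minimality do not mention the field, so they transfer from `F` to `K`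
  -- unchanged; only the vanishing of singular functions needs part (1).
  exact SteinbergAlgebra.isSimpleRing_of_effective_of_minimal
    (fun U hU hd => SteinbergAlgebra.subset_units_of_isSimpleRing F hU hd)
    (fun V hV hVu hne x hx => SteinbergAlgebra.exists_arrow_of_isSimpleRing F hV hVu hne hx)
    (singularIdeal_eq_bot_of_charP (F := F) p hp
      SteinbergAlgebra.singularIdeal_eq_bot_of_isSimpleRing)
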